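/- Let $\mathbb K$ be a field of characteristic zero. Operads are symmetric operads in $\mathbb Z$-graded $\mathbb K$-vector spaces, $\mathcal F(E)$ is the free operad on a graded $\mathbb S$-module $E$, $\mathcal F_{(2)}(E)\subset\mathcal F(E)$ is the span of the decorated trees with two vertices, and $(X)$ is the operadic ideal generated by $X$. All generators below have arity two, $V[k]$ denotes the shift with $V[k]^i=V^{i+k}$ (so $\mathbb K[-1]$ is in degree $1$), and elements of $\mathcal F_{(2)}(E)(3)$ are written as composites of binary operations applied to leaves labelled $a,b,c$, e.g. $x(y(a,b),c)=x\circ_1y$ and $x(a,y(b,c))=x\circ_2y$ up to relabelling. For an $\mathbb S$-module $E$ let $E^\vee(n)=E(n)^*\otimes\mathrm{sgn}_n$ (with $(E^\vee)_d$ dual to $E_{-d}$); let $\langle\ ,\ \rangle\colon\mathcal F_{(2)}(E^\vee)\otimes\mathcal F_{(2)}(E)\to\mathbb K$ be the natural pairing: different trees are orthogonal, $\langle f(g(a,b),c),x(y(a,b),c)\rangle=f(x)g(y)$ when $(a,b,c)$ is a cyclic rotation of $(1,2,3)$; thus $\langle\sigma u,\sigma v\rangle=\mathrm{sgn}(\sigma)\langle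 u,v\rangle$ for $\sigma\in\mathbb S_3$. The Koszul dual operad of $\mathcal P=\mathcal F(E)/(R)$, $R\subset\mathcal F_{(2)}(E)$, is $\mathcal P^!=\mathcal F(E^\vee)/(R^\perp)$. The operad $\mathcal{B}i\mathcal{N}ij=\mathcal F(M)/(R)$ has generators $M(2)=\mathbb 1_2[-1]\oplus\mathbb K[\mathbb S_2]\oplus\mathbb K[\mathbb S_2]$, $M(n)=0$ for $n\ne2$, where the natural generators are a symmetric bracket $[\,,]$ of degree $1$ and two products $\circ$, $\bullet$ of degree $0$; $R$ consists of the following relations, for all permutations $(a,b,c)$ of $(1,2,3)$: * $(a*b)*c-a*(b*c)-(a*c)*b+a*(c*b)$ for $*=\circ$ and for $*=\bullet$; * $(a\circ b)\bullet c-a\bullet(b\circ c)-(a\circ c)\bullet b+a\bullet(c\circ b)+(a\bullet b)\circ c-a\circ(b\bullet c)-(a\bullet c)\circ b+a\circ(c\bullet b)$; * $[[1,2],3]+[[2,3],1]+[[3,1],2]$; * $[a,b]*c+a*[b,c]+b*[a,c]-[a,b*c]-[b,a*c]$ for $*=\circ$ and for $*=\bullet$. **Proposition.** The Koszul dual operad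 of $\mathcal{B}i\mathcal{N}ij$ is the quadratic operad $\mathcal{B}i\mathcal{N}ij^!=\mathcal F(N)/(S)$, where $$N(2)=\mathrm{sgn}_2[1]\oplus\mathbb K[\mathbb S_2]\otimes\mathrm{sgn}_2\oplus\mathbb K[\mathbb S_2]\otimes\mathrm{sgn}_2,\qquad N(n)=0\ (n\neq2),$$ with natural generators $\nu$ (skew-symmetric, of degree $-1$), $\circ$ and $\bullet$ (of degree $0$), and $S$ consists of the following relations, for all permutations $(a,b,c)$ of $(1,2,3)$: * $(a\circ b)\circ c-a\circ(b\circ c)$, $(a\circ b)\circ c-(a\circ c)\circ b$, $(a\bullet b)\bullet c-a\bullet(b\bullet c)$, $(a\bullet b)\bullet c-(a\bullet c)\bullet b$; * $(a\circ b)\bullet c-a\bullet(b\circ c)$, $(a\circ b)\bullet c-(a\circ c)\bullet b$, $(a\bullet b)\circ c-a\circ(b\bullet c)$, $(a\bullet b)\circ c-(a\bullet c)\circ b$; * $(a\circ b)\bullet c-(a\bullet b)\circ c$, $a\bullet(b\circ c)-a\circ(b\bullet c)$; * $\nu(\nu(a,b),c)+\nu(a,\nu(b,c))$ (associativity of the odd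 operation $\nu$, the sign being the Koszul sign; equivalently $\nu(\nu(a,b),c)=\nu(\nu(b,c),a)$, as $\nu$ is skew); * $\nu(a*b,c)-\nu(a,c)*b$ and $a*\nu(b,c)-\nu(a,c)*b+\nu(a,b)*c$ for $*=\circ$ and for $*=\bullet$. More precisely, there is an isomorphism of graded $\mathbb S$-modules $\varphi\colon N\to M^\vee$ sending $\nu,\circ,\bullet$ to the functionals dual to $[\,,],\circ,\bullet$ (with respect to the basis of $M(2)$ consisting of the three generators and of $\circ(12)$, $\bullet(12)$). It carries the span of $S$ onto the orthogonal complement $R^\perp$, and it extends to an isomorphism of graded operads $\mathcal F(N)/(S)\cong\mathcal F(M^\vee)/(R^\perp)=\mathcal{B}i\mathcal{N}ij^!$. -/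

import Mathlib

open scoped TensorProduct DirectSum

universe u

namespace BiNijenhuis

/-! ## Graded operads

Composition is indexed by an input `i` of the first operation together with a bijection `e`
labelling the leaves of the grafted tree, so `comp i e a b` is the usual partial composite
`a ∘ᵢ b`, relabelled: a leaf `x ≠ i` of `a` gets the label `e (inl x)` and a leaf `y` of `b` gets
the label `e (inr y)`. The symmetric group acts by `act σ`: the leaf labelled `x` gets the
label `σ x`. -/

/-- Labellings of the tree obtained by grafting an `n`-corolla on the input `i` of an
`m`-corolla. -/
abbrev Graft {m : ℕ} (i : Fin m) (n k : ℕ) : Type := ({x : Fin m // x ≠ i} ⊕ Fin n) ≃ Fin k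

/-- The compatibility of labellings in `(a ∘ᵢ b) ∘ c = a ∘ᵢ (b ∘ⱼ c)`. -/
structure SeqCompat {m n l u v w : ℕ} {i : Fin m} {j : Fin n}
    (f : Graft j l u) (e : Graft i u w) (f' : Graft i n v) (e' : Graft (f' (Sum.inr j)) l w) :
    Prop where
  root : ∀ x : {x : Fin m // x ≠ i},
    e' (Sum.inl ⟨f' (Sum.inl x), f'.injective.ne Sum.inl_ne_inr⟩) = e (Sum.inl x)
  mid : ∀ y : {y : Fin n // y ≠ j},
    e' (Sum.inl ⟨f' (Sum.inr y.1), f'.injective.ne (Sum.inr_injective.ne y.2)⟩) =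
      e (Sum.inr (f (Sum.inl y)))
  top : ∀ z : Fin l, e' (Sum.inr z) = e (Sum.inr (f (Sum.inr z)))

/-- The compatibility of labellings in `(a ∘ᵢ b) ∘ₖ c = ± (a ∘ₖ c) ∘ᵢ b`, for `i ≠ k`. -/
structure ParCompat {m n l u u' w : ℕ} {i k : Fin m} (hik : i ≠ k)
    (f : Graft i n u) (g : Graft (f (Sum.inl ⟨k, hik.symm⟩)) l w)
    (f' : Graft k l u') (g' : Graft (f' (Sum.inl ⟨i, hik⟩)) n w) : Prop where
  root : ∀ (x : Fin m) (hi : x ≠ i) (hk : x ≠ k),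
    g (Sum.inl ⟨f (Sum.inl ⟨x, hi⟩),
        f.injective.ne (Sum.inl_injective.ne (fun h => hk (congrArg Subtype.val h)))⟩) =
      g' (Sum.inl ⟨f' (Sum.inl ⟨x, hk⟩),
        f'.injective.ne (Sum.inl_injective.ne (fun h => hi (congrArg Subtype.val h)))⟩)
  left : ∀ y : Fin n,
    g (Sum.inl ⟨f (Sum.inr y), f.injective.ne Sum.inr_ne_inl⟩) = g' (Sum.inr y)
  right : ∀ z : Fin l,
    g (Sum.inr z) = g' (Sum.inl ⟨f' (Sum.inr z), f'.injective.ne Sum.inr_ne_inl⟩)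

/-- The compatibility of labellings in `(σ a) ∘_{σ i} b = a ∘ᵢ b`. -/
structure ActCompat {m n k : ℕ} (σ : Equiv.Perm (Fin m)) {i : Fin m}
    (e : Graft (σ i) n k) (e' : Graft i n k) : Prop where
  root : ∀ x : {x : Fin m // x ≠ i},
    e (Sum.inl ⟨σ x.1, σ.injective.ne x.2⟩) = e' (Sum.inl x)
  top : ∀ y : Fin n, e (Sum.inr y) = e' (Sum.inr y)

/-- The relabelling `σ` with `a ∘ᵢ 1 = σ a`. -/
structure UnitCompat {m : ℕ} {i : Fin m} (e : Graft i 1 m) (σ : Equiv.Perm (Fin m)) :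
    Prop where
  root : ∀ x : {x : Fin m // x ≠ i}, e (Sum.inl x) = σ x.1
  top : e (Sum.inr 0) = σ i

/-- The Koszul sign `(-1) ^ (q * s)` in `K`. -/
def koszulSign (K : Type u) [Field K] (q s : ℤ) : K := (((q * s).negOnePow : ℤˣ) : ℤ)

/-- A symmetric unital operad in `ℤ`-graded `K`-vector spaces; `obj n d` is the space of
operations of arity `n` and degree `d`. -/
structure GrOperad (K : Type u) [Field K] where
  obj : ℕ → ℤ → Type u
  [acg : ∀ n d, AddCommGroup (obj n d)]
  [mod : ∀ n d, Module K (obj n d)]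
  one : obj 1 0
  act : ∀ {n : ℕ} {d : ℤ}, Equiv.Perm (Fin n) → (obj n d →ₗ[K] obj n d)
  comp : ∀ {m n k : ℕ} {p q r : ℤ} (i : Fin m) (_ : Graft i n k) (_ : p + q = r),
    obj m p →ₗ[K] obj n q →ₗ[K] obj k r
  act_one : ∀ {n : ℕ} {d : ℤ} (a : obj n d), act 1 a = a
  act_mul : ∀ {n : ℕ} {d : ℤ} (σ τ : Equiv.Perm (Fin n)) (a : obj n d),
    act (σ * τ) a = act σ (act τ a)
  act_comp : ∀ {m n k : ℕ} {p q r : ℤ} (i : Fin m) (e : Graft i n k) (h : p + q = r)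
    (τ : Equiv.Perm (Fin k)) (a : obj m p) (b : obj n q),
    act τ (comp i e h a b) = comp i (e.trans τ) h a b
  comp_act_left : ∀ {m n k : ℕ} {p q r : ℤ} (σ : Equiv.Perm (Fin m)) (i : Fin m)
    (e : Graft (σ i) n k) (e' : Graft i n k) (h : p + q = r) (a : obj m p) (b : obj n q),
    ActCompat σ e e' → comp (σ i) e h (act σ a) b = comp i e' h a b
  comp_act_right : ∀ {m n k : ℕ} {p q r : ℤ} (i : Fin m) (e : Graft i n k) (h : p + q = r)
    (τ : Equiv.Perm (Fin n)) (a : obj m p) (b : obj n q),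
    comp i e h a (act τ b) = comp i (((Equiv.refl _).sumCongr τ).trans e) h a b
  one_comp : ∀ {n : ℕ} {d : ℤ} (i : Fin 1) (e : Graft i n n) (h : 0 + d = d)
    (τ : Equiv.Perm (Fin n)) (a : obj n d), (∀ x, e (Sum.inr x) = τ x) →
    comp i e h one a = act τ a
  comp_one : ∀ {m : ℕ} {d : ℤ} (i : Fin m) (e : Graft i 1 m) (h : d + 0 = d)
    (σ : Equiv.Perm (Fin m)) (a : obj m d), UnitCompat e σ →
    comp i e h a one = act σ a
  comp_assoc : ∀ {m n l u v w : ℕ} {p q s pq qs t : ℤ} (i : Fin m) (j : Fin n)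
    (f : Graft j l u) (e : Graft i u w) (f' : Graft i n v) (e' : Graft (f' (Sum.inr j)) l w)
    (h₁ : p + q = pq) (h₂ : pq + s = t) (h₃ : q + s = qs) (h₄ : p + qs = t)
    (a : obj m p) (b : obj n q) (c : obj l s), SeqCompat f e f' e' →
    comp (f' (Sum.inr j)) e' h₂ (comp i f' h₁ a b) c = comp i e h₄ a (comp j f h₃ b c)
  comp_comm : ∀ {m n l u u' w : ℕ} {p q s pq ps t : ℤ} (i k : Fin m) (hik : i ≠ k)
    (f : Graft i n u) (g : Graft (f (Sum.inl ⟨k, hik.symm⟩)) l w)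
    (f' : Graft k l u') (g' : Graft (f' (Sum.inl ⟨i, hik⟩)) n w)
    (h₁ : p + q = pq) (h₂ : pq + s = t) (h₃ : p + s = ps) (h₄ : ps + q = t)
    (a : obj m p) (b : obj n q) (c : obj l s), ParCompat hik f g f' g' →
    comp (f (Sum.inl ⟨k, hik.symm⟩)) g h₂ (comp i f h₁ a b) c =
      koszulSign K q s • comp (f' (Sum.inl ⟨i, hik⟩)) g' h₄ (comp k f' h₃ a c) b

attribute [instance] GrOperad.acg GrOperad.mod

/-- An isomorphism of graded operads. -/
structure GrOperad.Iso {K : Type u} [Field K] (P Q : GrOperad K) where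
  toEquiv : ∀ (n : ℕ) (d : ℤ), P.obj n d ≃ₗ[K] Q.obj n d
  map_one : toEquiv 1 0 P.one = Q.one
  map_act : ∀ {n : ℕ} {d : ℤ} (σ : Equiv.Perm (Fin n)) (a : P.obj n d),
    toEquiv n d (P.act σ a) = Q.act σ (toEquiv n d a)
  map_comp : ∀ {m n k : ℕ} {p q r : ℤ} (i : Fin m) (e : Graft i n k) (h : p + q = r)
    (a : P.obj m p) (b : P.obj n q),
    toEquiv k r (P.comp i e h a b) = Q.comp i e h (toEquiv m p a) (toEquiv n q b)

/-! ## Operadic ideals and quotients -/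

/-- Membership in the operadic ideal generated by a family of sets of operations. -/
inductive InIdeal {K : Type u} [Field K] (P : GrOperad K) (X : ∀ n d, Set (P.obj n d)) :
    ∀ {n : ℕ} {d : ℤ}, P.obj n d → Prop
  | of {n d} (a : P.obj n d) : a ∈ X n d → InIdeal P X a
  | zero {n d} : InIdeal P X (0 : P.obj n d)
  | add {n d} (a b : P.obj n d) : InIdeal P X a → InIdeal P X b → InIdeal P X (a + b)
  | smul {n d} (c : K) (a : P.obj n d) : InIdeal P X a → InIdeal P X (c • a)
  | act {n d} (σ : Equiv.Perm (Fin n)) (a : P.obj n d) : InIdeal P X a →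
      InIdeal P X (P.act σ a)
  | comp_left {m n k p q r} (i : Fin m) (e : Graft i n k) (h : p + q = r) (a : P.obj m p)
      (b : P.obj n q) : InIdeal P X a → InIdeal P X (P.comp i e h a b)
  | comp_right {m n k p q r} (i : Fin m) (e : Graft i n k) (h : p + q = r) (a : P.obj m p)
      (b : P.obj n q) : InIdeal P X b → InIdeal P X (P.comp i e h a b)

/-- The operadic ideal generated by `X`, in arity `n` and degree `d`. -/
def genIdeal {K : Type u} [Field K] (P : GrOperad K) (X : ∀ n d, Set (P.obj n d))
    (n : ℕ) (d : ℤ) : Submodule K (P.obj n d) where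
  carrier := {a | InIdeal P X a}
  add_mem' := fun ha hb => InIdeal.add _ _ ha hb
  zero_mem' := InIdeal.zero
  smul_mem' := fun c _ ha => InIdeal.smul c _ ha

/-- The quotient of an operad by the operadic ideal generated by `X`. -/
def GrOperad.quot {K : Type u} [Field K] (P : GrOperad K) (X : ∀ n d, Set (P.obj n d)) :
    GrOperad K where
  obj := fun n d => P.obj n d ⧸ genIdeal P X n d
  one := Submodule.Quotient.mk P.one
  act := fun {n d} σ => (genIdeal P X n d).mapQ (genIdeal P X n d) (P.act σ)
    (fun a ha => InIdeal.act σ a ha)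
  comp := fun {m n k p q r} i e h =>
    (genIdeal P X m p).liftQ
      (LinearMap.flip ((genIdeal P X n q).liftQ
        (LinearMap.flip ((P.comp i e h).compr₂ (genIdeal P X k r).mkQ))
        (fun b hb => LinearMap.ext fun a =>
          (Submodule.Quotient.mk_eq_zero _).2 (InIdeal.comp_right i e h a b hb))))
      (fun a ha => LinearMap.ext fun b => by
        obtain ⟨b, rfl⟩ := Submodule.Quotient.mk_surjective _ b
        exact (Submodule.Quotient.mk_eq_zero _).2 (InIdeal.comp_left i e h a b ha))
  act_one := by
    intro n d a
    obtain ⟨a, rfl⟩ := Submodule.Quotient.mk_surjective _ a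
    exact congrArg Submodule.Quotient.mk (P.act_one a)
  act_mul := by
    intro n d σ τ a
    obtain ⟨a, rfl⟩ := Submodule.Quotient.mk_surjective _ a
    exact congrArg Submodule.Quotient.mk (P.act_mul σ τ a)
  act_comp := by
    intro m n k p q r i e h τ a b
    obtain ⟨a, rfl⟩ := Submodule.Quotient.mk_surjective _ a
    obtain ⟨b, rfl⟩ := Submodule.Quotient.mk_surjective _ b
    exact congrArg Submodule.Quotient.mk (P.act_comp i e h τ a b)
  comp_act_left := by
    intro m n k p q r σ i e e' h a b H
    obtain ⟨a, rfl⟩ := Submodule.Quotient.mk_surjective _ a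
    obtain ⟨b, rfl⟩ := Submodule.Quotient.mk_surjective _ b
    exact congrArg Submodule.Quotient.mk (P.comp_act_left σ i e e' h a b H)
  comp_act_right := by
    intro m n k p q r i e h τ a b
    obtain ⟨a, rfl⟩ := Submodule.Quotient.mk_surjective _ a
    obtain ⟨b, rfl⟩ := Submodule.Quotient.mk_surjective _ b
    exact congrArg Submodule.Quotient.mk (P.comp_act_right i e h τ a b)
  one_comp := by
    intro n d i e h τ a H
    obtain ⟨a, rfl⟩ := Submodule.Quotient.mk_surjective _ a
    exact congrArg Submodule.Quotient.mk (P.one_comp i e h τ a H)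
  comp_one := by
    intro m d i e h σ a H
    obtain ⟨a, rfl⟩ := Submodule.Quotient.mk_surjective _ a
    exact congrArg Submodule.Quotient.mk (P.comp_one i e h σ a H)
  comp_assoc := by
    intro m n l u v w p q s pq qs t i j f e f' e' h₁ h₂ h₃ h₄ a b c H
    obtain ⟨a, rfl⟩ := Submodule.Quotient.mk_surjective _ a
    obtain ⟨b, rfl⟩ := Submodule.Quotient.mk_surjective _ b
    obtain ⟨c, rfl⟩ := Submodule.Quotient.mk_surjective _ c
    exact congrArg Submodule.Quotient.mk
      (P.comp_assoc i j f e f' e' h₁ h₂ h₃ h₄ a b c H)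
  comp_comm := by
    intro m n l u u' w p q s pq ps t i k hik f g f' g' h₁ h₂ h₃ h₄ a b c H
    obtain ⟨a, rfl⟩ := Submodule.Quotient.mk_surjective _ a
    obtain ⟨b, rfl⟩ := Submodule.Quotient.mk_surjective _ b
    obtain ⟨c, rfl⟩ := Submodule.Quotient.mk_surjective _ c
    exact congrArg Submodule.Quotient.mk
      (P.comp_comm i k hik f g f' g' h₁ h₂ h₃ h₄ a b c H)

/-! ## Graded `𝕊`-modules concentrated in arity two -/

/-- A graded `𝕊`-module `E` with `E(n) = 0` for `n ≠ 2`, given by the graded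
`𝕊₂`-representation `E(2)`; `obj d` is its part of degree `d`. -/
structure BinModule (K : Type u) [Field K] where
  obj : ℤ → Type u
  [acg : ∀ d, AddCommGroup (obj d)]
  [mod : ∀ d, Module K (obj d)]
  rep : ∀ d, Representation K (Equiv.Perm (Fin 2)) (obj d)

attribute [instance] BinModule.acg BinModule.mod

/-- The tensor product of a representation of `𝕊ₙ` with the sign representation. -/
def sgnTwist {K : Type u} [Field K] {n : ℕ} {V : Type u} [AddCommGroup V] [Module K V]
    (ρ : Representation K (Equiv.Perm (Fin n)) V) :
    Representation K (Equiv.Perm (Fin n)) V where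
  toFun := fun σ => (((Equiv.Perm.sign σ : ℤˣ) : ℤ) : K) • ρ σ
  map_one' := by simp
  map_mul' := by
    intro σ τ
    ext v
    simp only [Units.val_mul, Int.cast_mul, map_mul, LinearMap.smul_apply,
      Module.End.mul_apply, map_smul, mul_smul]
    exact smul_comm _ _ _

/-- A representation of `𝕊₂` placed in the single degree `d₀`: the space of functions
`(d = d₀) → V` is a copy of `V` if `d = d₀`, and zero otherwise. -/
def BinModule.inDegree {K : Type u} [Field K] {V : Type u} [AddCommGroup V] [Module K V]
    (ρ : Representation K (Equiv.Perm (Fin 2)) V) (d₀ : ℤ) : BinModule K where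
  obj := fun d => PLift (d = d₀) → V
  rep := fun _ =>
    { toFun := fun σ => LinearMap.pi fun h => (ρ σ).comp (LinearMap.proj h)
      map_one' := by ext; simp
      map_mul' := by intro σ τ; ext; simp }

/-- The direct sum of two graded `𝕊₂`-modules. -/
def BinModule.prod {K : Type u} [Field K] (E F : BinModule K) : BinModule K where
  obj := fun d => E.obj d × F.obj d
  rep := fun d =>
    { toFun := fun σ => (E.rep d σ).prodMap (F.rep d σ)
      map_one' := by ext <;> simp
      map_mul' := by intro σ τ; ext <;> simp }

/-- The Czech dual `E^∨ = E^* ⊗ sgn`, with `(E^∨)_d = (E_{-d})^* ⊗ sgn`. -/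
def BinModule.czechDual {K : Type u} [Field K] (E : BinModule K) : BinModule K where
  obj := fun d => Module.Dual K (E.obj (-d))
  rep := fun d => sgnTwist (E.rep (-d)).dual

/-- An isomorphism of graded `𝕊₂`-modules. -/
structure BinModule.Iso {K : Type u} [Field K] (E F : BinModule K) where
  toEquiv : ∀ d : ℤ, E.obj d ≃ₗ[K] F.obj d
  map_rep : ∀ (d : ℤ) (σ : Equiv.Perm (Fin 2)) (x : E.obj d),
    toEquiv d (E.rep d σ x) = F.rep d σ (toEquiv d x)

/-! ## The free operad

The free operad is the space of formal expressions in the generators and the operad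
operations, modulo the smallest congruence containing linearity, equivariance and the operad
axioms. -/

/-- Formal operadic expressions in the generators `E`, by arity and degree. -/
inductive Pre {K : Type u} [Field K] (E : BinModule K) : ℕ → ℤ → Type u
  | gen {d : ℤ} (x : E.obj d) : Pre E 2 d
  | one : Pre E 1 0
  | zero {n : ℕ} {d : ℤ} : Pre E n d
  | add {n : ℕ} {d : ℤ} (a b : Pre E n d) : Pre E n d
  | smul {n : ℕ} {d : ℤ} (c : K) (a : Pre E n d) : Pre E n d
  | act {n : ℕ} {d : ℤ} (σ : Equiv.Perm (Fin n)) (a : Pre E n d) : Pre E n d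
  | comp {m n k : ℕ} {p q r : ℤ} (i : Fin m) (e : Graft i n k) (h : p + q = r)
      (a : Pre E m p) (b : Pre E n q) : Pre E k r

/-- The congruence on formal expressions defining the free operad. -/
inductive Rel {K : Type u} [Field K] (E : BinModule K) :
    ∀ {n : ℕ} {d : ℤ}, Pre E n d → Pre E n d → Prop
  -- equivalence relation
  | refl {n d} (a : Pre E n d) : Rel E a a
  | symm {n d} {a b : Pre E n d} : Rel E a b → Rel E b a
  | trans {n d} {a b c : Pre E n d} : Rel E a b → Rel E b c → Rel E a c
  -- congruence
  | add_congr {n d} {a a' b b' : Pre E n d} : Rel E a a' → Rel E b b' →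
      Rel E (a.add b) (a'.add b')
  | smul_congr {n d} (c : K) {a a' : Pre E n d} : Rel E a a' → Rel E (a.smul c) (a'.smul c)
  | act_congr {n d} (σ : Equiv.Perm (Fin n)) {a a' : Pre E n d} : Rel E a a' →
      Rel E (a.act σ) (a'.act σ)
  | comp_congr {m n k p q r} (i : Fin m) (e : Graft i n k) (h : p + q = r)
      {a a' : Pre E m p} {b b' : Pre E n q} : Rel E a a' → Rel E b b' →
      Rel E (Pre.comp i e h a b) (Pre.comp i e h a' b')
  -- vector space axioms
  | add_comm {n d} (a b : Pre E n d) : Rel E (a.add b) (b.add a)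
  | add_assoc {n d} (a b c : Pre E n d) : Rel E ((a.add b).add c) (a.add (b.add c))
  | zero_add {n d} (a : Pre E n d) : Rel E (Pre.zero.add a) a
  | one_smul {n d} (a : Pre E n d) : Rel E (a.smul 1) a
  | zero_smul {n d} (a : Pre E n d) : Rel E (a.smul 0) Pre.zero
  | mul_smul {n d} (c c' : K) (a : Pre E n d) : Rel E (a.smul (c * c')) ((a.smul c').smul c)
  | add_smul {n d} (c c' : K) (a : Pre E n d) :
      Rel E (a.smul (c + c')) ((a.smul c).add (a.smul c'))
  | smul_add {n d} (c : K) (a b : Pre E n d) :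
      Rel E ((a.add b).smul c) ((a.smul c).add (b.smul c))
  -- the generators form a representation
  | gen_add {d} (x y : E.obj d) : Rel E (Pre.gen (x + y)) ((Pre.gen x).add (Pre.gen y))
  | gen_smul {d} (c : K) (x : E.obj d) : Rel E (Pre.gen (c • x)) ((Pre.gen x).smul c)
  | gen_act {d} (σ : Equiv.Perm (Fin 2)) (x : E.obj d) :
      Rel E (Pre.gen (E.rep d σ x)) ((Pre.gen x).act σ)
  -- linearity of the operations
  | act_add {n d} (σ : Equiv.Perm (Fin n)) (a b : Pre E n d) :
      Rel E ((a.add b).act σ) ((a.act σ).add (b.act σ))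
  | act_smul {n d} (σ : Equiv.Perm (Fin n)) (c : K) (a : Pre E n d) :
      Rel E ((a.smul c).act σ) ((a.act σ).smul c)
  | add_comp {m n k p q r} (i : Fin m) (e : Graft i n k) (h : p + q = r)
      (a a' : Pre E m p) (b : Pre E n q) :
      Rel E (Pre.comp i e h (a.add a') b) ((Pre.comp i e h a b).add (Pre.comp i e h a' b))
  | smul_comp {m n k p q r} (i : Fin m) (e : Graft i n k) (h : p + q = r) (c : K)
      (a : Pre E m p) (b : Pre E n q) :
      Rel E (Pre.comp i e h (a.smul c) b) ((Pre.comp i e h a b).smul c)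
  | comp_add {m n k p q r} (i : Fin m) (e : Graft i n k) (h : p + q = r)
      (a : Pre E m p) (b b' : Pre E n q) :
      Rel E (Pre.comp i e h a (b.add b')) ((Pre.comp i e h a b).add (Pre.comp i e h a b'))
  | comp_smul {m n k p q r} (i : Fin m) (e : Graft i n k) (h : p + q = r) (c : K)
      (a : Pre E m p) (b : Pre E n q) :
      Rel E (Pre.comp i e h a (b.smul c)) ((Pre.comp i e h a b).smul c)
  -- operad axioms
  | act_one {n d} (a : Pre E n d) : Rel E (a.act 1) a
  | act_mul {n d} (σ τ : Equiv.Perm (Fin n)) (a : Pre E n d) :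
      Rel E (a.act (σ * τ)) ((a.act τ).act σ)
  | act_comp {m n k p q r} (i : Fin m) (e : Graft i n k) (h : p + q = r)
      (τ : Equiv.Perm (Fin k)) (a : Pre E m p) (b : Pre E n q) :
      Rel E ((Pre.comp i e h a b).act τ) (Pre.comp i (e.trans τ) h a b)
  | comp_act_left {m n k p q r} (σ : Equiv.Perm (Fin m)) (i : Fin m) (e : Graft (σ i) n k)
      (e' : Graft i n k) (h : p + q = r) (a : Pre E m p) (b : Pre E n q) :
      ActCompat σ e e' → Rel E (Pre.comp (σ i) e h (a.act σ) b) (Pre.comp i e' h a b)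
  | comp_act_right {m n k p q r} (i : Fin m) (e : Graft i n k) (h : p + q = r)
      (τ : Equiv.Perm (Fin n)) (a : Pre E m p) (b : Pre E n q) :
      Rel E (Pre.comp i e h a (b.act τ))
        (Pre.comp i (((Equiv.refl _).sumCongr τ).trans e) h a b)
  | one_comp {n d} (i : Fin 1) (e : Graft i n n) (h : 0 + d = d) (τ : Equiv.Perm (Fin n))
      (a : Pre E n d) : (∀ x, e (Sum.inr x) = τ x) → Rel E (Pre.comp i e h Pre.one a) (a.act τ)
  | comp_one {m d} (i : Fin m) (e : Graft i 1 m) (h : d + 0 = d) (σ : Equiv.Perm (Fin m))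
      (a : Pre E m d) : UnitCompat e σ → Rel E (Pre.comp i e h a Pre.one) (a.act σ)
  | comp_assoc {m n l u v w : ℕ} {p q s pq qs t : ℤ} (i : Fin m) (j : Fin n)
      (f : Graft j l u) (e : Graft i u w) (f' : Graft i n v) (e' : Graft (f' (Sum.inr j)) l w)
      (h₁ : p + q = pq) (h₂ : pq + s = t) (h₃ : q + s = qs) (h₄ : p + qs = t)
      (a : Pre E m p) (b : Pre E n q) (c : Pre E l s) : SeqCompat f e f' e' →
      Rel E (Pre.comp (f' (Sum.inr j)) e' h₂ (Pre.comp i f' h₁ a b) c)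
        (Pre.comp i e h₄ a (Pre.comp j f h₃ b c))
  | comp_comm {m n l u u' w : ℕ} {p q s pq ps t : ℤ} (i k : Fin m) (hik : i ≠ k)
      (f : Graft i n u) (g : Graft (f (Sum.inl ⟨k, hik.symm⟩)) l w)
      (f' : Graft k l u') (g' : Graft (f' (Sum.inl ⟨i, hik⟩)) n w)
      (h₁ : p + q = pq) (h₂ : pq + s = t) (h₃ : p + s = ps) (h₄ : ps + q = t)
      (a : Pre E m p) (b : Pre E n q) (c : Pre E l s) : ParCompat hik f g f' g' →
      Rel E (Pre.comp (f (Sum.inl ⟨k, hik.symm⟩)) g h₂ (Pre.comp i f h₁ a b) c)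
        ((Pre.comp (f' (Sum.inl ⟨i, hik⟩)) g' h₄ (Pre.comp k f' h₃ a c) b).smul
          (koszulSign K q s))

/-- The congruence as a setoid. -/
def relSetoid {K : Type u} [Field K] (E : BinModule K) (n : ℕ) (d : ℤ) :
    Setoid (Pre E n d) where
  r := Rel E
  iseqv := ⟨Rel.refl, Rel.symm, Rel.trans⟩

/-- The free operad in arity `n` and degree `d`. -/
def FreeObj {K : Type u} [Field K] (E : BinModule K) (n : ℕ) (d : ℤ) : Type u :=
  Quotient (relSetoid E n d)

/-- The class of a formal expression in the free operad. -/
def FreeObj.mk {K : Type u} [Field K] {E : BinModule K} {n : ℕ} {d : ℤ} (a : Pre E n d) :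
    FreeObj E n d := Quotient.mk (relSetoid E n d) a

theorem FreeObj.sound {K : Type u} [Field K] {E : BinModule K} {n : ℕ} {d : ℤ}
    {a b : Pre E n d} (h : Rel E a b) : FreeObj.mk a = FreeObj.mk b :=
  Quotient.sound (s := relSetoid E n d) h

instance FreeObj.instZero {K : Type u} [Field K] (E : BinModule K) (n : ℕ) (d : ℤ) :
    Zero (FreeObj E n d) where
  zero := FreeObj.mk Pre.zero

instance FreeObj.instAdd {K : Type u} [Field K] (E : BinModule K) (n : ℕ) (d : ℤ) :
    Add (FreeObj E n d) where
  add := Quotient.map₂ Pre.add (fun _ _ h _ _ h' => Rel.add_congr h h')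

instance FreeObj.instNeg {K : Type u} [Field K] (E : BinModule K) (n : ℕ) (d : ℤ) :
    Neg (FreeObj E n d) where
  neg := Quotient.map (Pre.smul (-1)) (fun _ _ h => Rel.smul_congr (-1) h)

instance FreeObj.instAddCommGroup {K : Type u} [Field K] (E : BinModule K) (n : ℕ) (d : ℤ) :
    AddCommGroup (FreeObj E n d) where
  add_assoc := by
    rintro ⟨a⟩ ⟨b⟩ ⟨c⟩
    exact FreeObj.sound (Rel.add_assoc a b c)
  zero_add := by
    rintro ⟨a⟩
    exact FreeObj.sound (Rel.zero_add a)
  add_zero := by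
    rintro ⟨a⟩
    exact FreeObj.sound ((Rel.add_comm a Pre.zero).trans (Rel.zero_add a))
  add_comm := by
    rintro ⟨a⟩ ⟨b⟩
    exact FreeObj.sound (Rel.add_comm a b)
  neg_add_cancel := by
    rintro ⟨a⟩
    refine FreeObj.sound (((Rel.add_congr (Rel.refl _) (Rel.one_smul a).symm).trans
      (Rel.add_smul (-1) 1 a).symm).trans ?_)
    rw [neg_add_cancel]
    exact Rel.zero_smul a
  nsmul := nsmulRec
  zsmul := zsmulRec

instance FreeObj.instModule {K : Type u} [Field K] (E : BinModule K) (n : ℕ) (d : ℤ) :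
    Module K (FreeObj E n d) where
  smul := fun c => Quotient.map (Pre.smul c) (fun _ _ h => Rel.smul_congr c h)
  one_smul := by
    rintro ⟨a⟩
    exact FreeObj.sound (Rel.one_smul a)
  mul_smul := by
    rintro c c' ⟨a⟩
    exact FreeObj.sound (Rel.mul_smul c c' a)
  smul_zero := by
    intro c
    refine FreeObj.sound (((Rel.smul_congr c (Rel.zero_smul Pre.zero).symm).trans
      (Rel.mul_smul c 0 Pre.zero).symm).trans ?_)
    rw [mul_zero]
    exact Rel.zero_smul Pre.zero
  smul_add := by
    rintro c ⟨a⟩ ⟨b⟩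
    exact FreeObj.sound (Rel.smul_add c a b)
  add_smul := by
    rintro c c' ⟨a⟩
    exact FreeObj.sound (Rel.add_smul c c' a)
  zero_smul := by
    rintro ⟨a⟩
    exact FreeObj.sound (Rel.zero_smul a)

/-- The free operad `𝓕(E)`. -/
def freeOperad {K : Type u} [Field K] (E : BinModule K) : GrOperad K where
  obj := FreeObj E
  one := FreeObj.mk Pre.one
  act := fun σ =>
    { toFun := Quotient.map (Pre.act σ) (fun _ _ h => Rel.act_congr σ h)
      map_add' := by
        rintro ⟨a⟩ ⟨b⟩
        exact FreeObj.sound (Rel.act_add σ a b)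
      map_smul' := by
        rintro c ⟨a⟩
        exact FreeObj.sound (Rel.act_smul σ c a) }
  comp := fun i e h => LinearMap.mk₂ K
    (Quotient.map₂ (Pre.comp i e h) (fun _ _ h₁ _ _ h₂ => Rel.comp_congr i e h h₁ h₂))
    (by rintro ⟨a⟩ ⟨a'⟩ ⟨b⟩; exact FreeObj.sound (Rel.add_comp i e h a a' b))
    (by rintro c ⟨a⟩ ⟨b⟩; exact FreeObj.sound (Rel.smul_comp i e h c a b))
    (by rintro ⟨a⟩ ⟨b⟩ ⟨b'⟩; exact FreeObj.sound (Rel.comp_add i e h a b b'))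
    (by rintro c ⟨a⟩ ⟨b⟩; exact FreeObj.sound (Rel.comp_smul i e h c a b))
  act_one := by
    rintro n d ⟨a⟩
    exact FreeObj.sound (Rel.act_one a)
  act_mul := by
    rintro n d σ τ ⟨a⟩
    exact FreeObj.sound (Rel.act_mul σ τ a)
  act_comp := by
    rintro m n k p q r i e h τ ⟨a⟩ ⟨b⟩
    exact FreeObj.sound (Rel.act_comp i e h τ a b)
  comp_act_left := by
    rintro m n k p q r σ i e e' h ⟨a⟩ ⟨b⟩ H
    exact FreeObj.sound (Rel.comp_act_left σ i e e' h a b H)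
  comp_act_right := by
    rintro m n k p q r i e h τ ⟨a⟩ ⟨b⟩
    exact FreeObj.sound (Rel.comp_act_right i e h τ a b)
  one_comp := by
    rintro n d i e h τ ⟨a⟩ H
    exact FreeObj.sound (Rel.one_comp i e h τ a H)
  comp_one := by
    rintro m d i e h σ ⟨a⟩ H
    exact FreeObj.sound (Rel.comp_one i e h σ a H)
  comp_assoc := by
    rintro m n l u v w p q s pq qs t i j f e f' e' h₁ h₂ h₃ h₄ ⟨a⟩ ⟨b⟩ ⟨c⟩ H
    exact FreeObj.sound (Rel.comp_assoc i j f e f' e' h₁ h₂ h₃ h₄ a b c H)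
  comp_comm := by
    rintro m n l u u' w p q s pq ps t i k hik f g f' g' h₁ h₂ h₃ h₄ ⟨a⟩ ⟨b⟩ ⟨c⟩ H
    exact FreeObj.sound (Rel.comp_comm i k hik f g f' g' h₁ h₂ h₃ h₄ a b c H)

/-- The inclusion of the generators in the free operad. -/
def freeGen {K : Type u} [Field K] (E : BinModule K) (d : ℤ) :
    E.obj d →ₗ[K] (freeOperad E).obj 2 d where
  toFun := fun x => FreeObj.mk (Pre.gen x)
  map_add' := fun x y => FreeObj.sound (Rel.gen_add x y)
  map_smul' := fun c x => FreeObj.sound (Rel.gen_smul c x)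

/-! ## The quadratic part of the free operad

A tree with two binary vertices is determined by the label `t` of the leaf attached to the
root vertex. Such a tree is drawn as `x(y(t + 1, t + 2), t)` with the labels taken modulo `3`,
where `x` decorates the root vertex and `y` the other vertex. Thus the weight two part of
`𝓕(E)`, which lives in arity `3`, is the direct sum of three copies of `E(2) ⊗ E(2)`. The
leaf labels `1, 2, 3` are the elements `0, 1, 2` of `Fin 3`. -/

/-- The weight two part `𝓕₍₂₎(E)` of the free operad: the component with index `(t, p, q)`
consists of the trees with label `t` at the root, a root vertex decorated in degree `p` and an
upper vertex decorated in degree `q`. -/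
abbrev Quad {K : Type u} [Field K] (E : BinModule K) : Type u :=
  ⨁ s : Fin 3 × ℤ × ℤ, (E.obj s.2.1 ⊗[K] E.obj s.2.2)

/-- The labels of the leaves of the tree `x(y(t + 1, t + 2), t)`. -/
def treeLabel (t : Fin 3) : ({x : Fin 2 // x ≠ 0} ⊕ Fin 2) → Fin 3
  | Sum.inl _ => t
  | Sum.inr y => if y = 0 then t + 1 else t + 2

/-- The labelling of the tree `x(y(t + 1, t + 2), t)`. -/
noncomputable def treeGraft (t : Fin 3) : Graft (0 : Fin 2) 2 3 :=
  Equiv.ofBijective (treeLabel t) (by revert t; decide)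

/-- The embedding of the weight two part in the free operad, the target being the direct sum
of all degrees in arity three. -/
noncomputable def quadEval {K : Type u} [Field K] (E : BinModule K) :
    Quad E →ₗ[K] ⨁ d : ℤ, (freeOperad E).obj 3 d :=
  DirectSum.toModule K (Fin 3 × ℤ × ℤ) (⨁ d : ℤ, (freeOperad E).obj 3 d) fun s =>
    (DirectSum.lof K ℤ (fun d => (freeOperad E).obj 3 d) (s.2.1 + s.2.2)).comp
      (TensorProduct.lift
        (((freeOperad E).comp (0 : Fin 2) (treeGraft s.1) rfl).compl₁₂
          (freeGen E s.2.1) (freeGen E s.2.2)))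

/-- The tree monomial `x(y(a, b), c)` with root vertex `x`, where `(a, b, c)` is
`(σ 0, σ 1, σ 2)`. It is already in the chosen form if `(a, b, c)` is a cyclic rotation of
`(0, 1, 2)`; otherwise the two inputs of `y` have to be exchanged. -/
noncomputable def leftTree {K : Type u} [Field K] (E : BinModule K) {p q : ℤ}
    (x : E.obj p) (y : E.obj q) (σ : Equiv.Perm (Fin 3)) : Quad E :=
  DirectSum.lof K (Fin 3 × ℤ × ℤ) (fun s => E.obj s.2.1 ⊗[K] E.obj s.2.2) (σ 2, p, q)
    (x ⊗ₜ[K] (if Equiv.Perm.sign σ = 1 then y else E.rep q (Equiv.swap 0 1) y))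

/-- The tree monomial `x(a, y(b, c))` with root vertex `x`, where `(a, b, c)` is
`(σ 0, σ 1, σ 2)`. It equals `x'(y(b, c), a)` for `x' = (12) x`. -/
noncomputable def rightTree {K : Type u} [Field K] (E : BinModule K) {p q : ℤ}
    (x : E.obj p) (y : E.obj q) (σ : Equiv.Perm (Fin 3)) : Quad E :=
  leftTree E (E.rep p (Equiv.swap 0 1) x) y (σ * finRotate 3)

/-- The map on weight two parts induced by an isomorphism of generators. -/
noncomputable def quadMap {K : Type u} [Field K] {E F : BinModule K} (φ : E.Iso F) :
    Quad E →ₗ[K] Quad F :=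
  DirectSum.lmap fun s : Fin 3 × ℤ × ℤ =>
    TensorProduct.map (φ.toEquiv s.2.1).toLinearMap (φ.toEquiv s.2.2).toLinearMap

/-- The natural pairing of the weight two parts of `𝓕(E^∨)` and `𝓕(E)`: different trees are
orthogonal, and on a tree in the chosen form decorations are paired vertex by vertex. As the
action on `E^∨` is twisted by the sign and the chosen forms of the three trees are cyclic
rotations of each other, `⟨σ f, σ x⟩ = sgn(σ) ⟨f, x⟩` for all `σ` in `𝕊₃`. -/
noncomputable def quadPairing {K : Type u} [Field K] (E : BinModule K) :
    Quad E.czechDual →ₗ[K] Quad E →ₗ[K] K :=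
  DirectSum.toModule K (Fin 3 × ℤ × ℤ) (Quad E →ₗ[K] K) fun s =>
    (LinearMap.lcomp K K (DirectSum.component K (Fin 3 × ℤ × ℤ)
        (fun s => E.obj s.2.1 ⊗[K] E.obj s.2.2) (s.1, -s.2.1, -s.2.2))).comp
      (TensorProduct.dualDistrib K (E.obj (-s.2.1)) (E.obj (-s.2.2)))

/-! ## Quadratic operads and Koszul duals -/

/-- A presentation of a binary quadratic operad by generators and relations. -/
structure QuadraticData (K : Type u) [Field K] where
  gens : BinModule K
  rels : Submodule K (Quad gens)

/-- The homogeneous components of the relations, as elements of the free operad. -/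
noncomputable def QuadraticData.relators {K : Type u} [Field K] (D : QuadraticData K) :
    ∀ (n : ℕ) (d : ℤ), Set ((freeOperad D.gens).obj n d)
  | 3, d => {a | ∃ r ∈ D.rels, quadEval D.gens r d = a}
  | _, _ => ∅

/-- The quadratic operad `𝓕(E)/(R)`. -/
noncomputable def QuadraticData.operad {K : Type u} [Field K] (D : QuadraticData K) :
    GrOperad K :=
  (freeOperad D.gens).quot D.relators

/-- The image of a generator in the quadratic operad `𝓕(E)/(R)`. -/
noncomputable def QuadraticData.gen {K : Type u} [Field K] (D : QuadraticData K) {d : ℤ}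
    (x : D.gens.obj d) : D.operad.obj 2 d :=
  (genIdeal (freeOperad D.gens) D.relators 2 d).mkQ (freeGen D.gens d x)

/-- The orthogonal complement `R^⊥` of the relations in the weight two part of `𝓕(E^∨)`. -/
noncomputable def QuadraticData.orth {K : Type u} [Field K] (D : QuadraticData K) :
    Submodule K (Quad D.gens.czechDual) where
  carrier := {f | ∀ r ∈ D.rels, quadPairing D.gens f r = 0}
  add_mem' := by
    intro f g hf hg r hr
    rw [map_add, LinearMap.add_apply, hf r hr, hg r hr, add_zero]
  zero_mem' := by
    intro r _
    rw [map_zero, LinearMap.zero_apply]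
  smul_mem' := by
    intro c f hf r hr
    rw [map_smul, LinearMap.smul_apply, hf r hr, smul_zero]

/-- The presentation `(E^∨, R^⊥)` of the Koszul dual operad of `𝓕(E)/(R)`. -/
noncomputable def QuadraticData.koszulDual {K : Type u} [Field K] (D : QuadraticData K) :
    QuadraticData K where
  gens := D.gens.czechDual
  rels := D.orth

/-! ## The operad of bi-Nijenhuis structures -/

/-- The regular representation `K[𝕊₂]`; its elements are functions on `𝕊₂`, and
`(σ f)(τ) = f(σ⁻¹ τ)`. -/
def regular (K : Type u) [Field K] :
    Representation K (Equiv.Perm (Fin 2)) (Equiv.Perm (Fin 2) → K) where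
  toFun := fun σ => LinearMap.funLeft K K (fun τ => σ⁻¹ * τ)
  map_one' := by
    ext f τ
    simp [LinearMap.funLeft_apply]
  map_mul' := by
    intro σ τ
    ext f x
    simp [LinearMap.funLeft_apply, mul_assoc]

/-- The unit element of `K[𝕊₂]`. -/
def regOne (K : Type u) [Field K] : Equiv.Perm (Fin 2) → K := Pi.single 1 1

/-- The generators of the bi-Nijenhuis operad: the trivial representation in degree `1`
(that is, `𝟙₂[-1]`) and two copies of `K[𝕊₂]` in degree `0`. -/
def genM (K : Type u) [Field K] : BinModule K :=
  (BinModule.inDegree (Representation.trivial K (Equiv.Perm (Fin 2)) K) 1).prod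
    ((BinModule.inDegree (regular K) 0).prod (BinModule.inDegree (regular K) 0))

/-- The generator of `𝟙₂[-1]`, the odd Lie bracket. -/
def mY (K : Type u) [Field K] : (genM K).obj 1 := (fun _ => 1, 0, 0)

/-- The first (white) pre-Lie product. -/
def mW (K : Type u) [Field K] : (genM K).obj 0 := (0, fun _ => regOne K, 0)

/-- The second (black) pre-Lie product. -/
def mB (K : Type u) [Field K] : (genM K).obj 0 := (0, 0, fun _ => regOne K)

/-- The pre-Lie relation `(a x b) x c - a x (b x c) - (a x c) x b + a x (c x b)`, polarised:
the inner product is `y`, the outer one is `x`. -/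
noncomputable def preLieRel {K : Type u} [Field K] (E : BinModule K) {p q : ℤ}
    (x : E.obj p) (y : E.obj q) (σ : Equiv.Perm (Fin 3)) : Quad E :=
  leftTree E x y σ - rightTree E x y σ
    - leftTree E x y (σ * Equiv.swap 1 2) + rightTree E x y (σ * Equiv.swap 1 2)

/-- The compatibility of a bracket `y` and a pre-Lie product `x`:
`y(a, b) x c + a x y(b, c) + b x y(a, c) - y(a, b x c) - y(b, a x c)`. -/
noncomputable def nijRel {K : Type u} [Field K] (E : BinModule K) {p q : ℤ}
    (x : E.obj p) (y : E.obj q) (σ : Equiv.Perm (Fin 3)) : Quad E :=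
  leftTree E x y σ + rightTree E x y σ + rightTree E x y (σ * Equiv.swap 0 1)
    - rightTree E y x σ - rightTree E y x (σ * Equiv.swap 0 1)

/-- The relations `R` of the bi-Nijenhuis operad; the labels `(a, b, c)` of the leaves are
`(σ 0, σ 1, σ 2)`. -/
def relR (K : Type u) [Field K] : Set (Quad (genM K)) :=
  {r | ∃ σ : Equiv.Perm (Fin 3),
    r = preLieRel (genM K) (mW K) (mW K) σ ∨
    r = preLieRel (genM K) (mB K) (mB K) σ ∨
    r = preLieRel (genM K) (mB K) (mW K) σ + preLieRel (genM K) (mW K) (mB K) σ ∨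
    r = leftTree (genM K) (mY K) (mY K) 1 + leftTree (genM K) (mY K) (mY K) (finRotate 3)
      + leftTree (genM K) (mY K) (mY K) (finRotate 3 * finRotate 3) ∨
    r = nijRel (genM K) (mW K) (mY K) σ ∨
    r = nijRel (genM K) (mB K) (mY K) σ}

/-- The presentation of the bi-Nijenhuis operad. -/
noncomputable def biNij (K : Type u) [Field K] : QuadraticData K where
  gens := genM K
  rels := Submodule.span K (relR K)

/-- The generators of the dual operad: the sign representation in degree `-1` (that is,
`sgn₂[1]`) and two copies of `K[𝕊₂] ⊗ sgn₂` in degree `0`. -/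
def genN (K : Type u) [Field K] : BinModule K :=
  (BinModule.inDegree
      (sgnTwist (Representation.trivial K (Equiv.Perm (Fin 2)) K)) (-1)).prod
    ((BinModule.inDegree (sgnTwist (regular K)) 0).prod
      (BinModule.inDegree (sgnTwist (regular K)) 0))

/-- The generator of `sgn₂[1]`. -/
def nY (K : Type u) [Field K] : (genN K).obj (-1) := (fun _ => 1, 0, 0)

/-- The generator of the first (white) copy of `K[𝕊₂] ⊗ sgn₂`. -/
def nW (K : Type u) [Field K] : (genN K).obj 0 := (0, fun _ => regOne K, 0)

/-- The generator of the second (black) copy of `K[𝕊₂] ⊗ sgn₂`. -/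
def nB (K : Type u) [Field K] : (genN K).obj 0 := (0, 0, fun _ => regOne K)

/-- The relations `S`; the labels `(a, b, c)` of the leaves are `(σ 0, σ 1, σ 2)`. In
`leftTree E x y` and `rightTree E x y` the root vertex is `x`. -/
def relS (K : Type u) [Field K] : Set (Quad (genN K)) :=
  {r | ∃ σ : Equiv.Perm (Fin 3),
    r = leftTree (genN K) (nW K) (nW K) σ - rightTree (genN K) (nW K) (nW K) σ ∨
    r = leftTree (genN K) (nW K) (nW K) σ
      - leftTree (genN K) (nW K) (nW K) (σ * Equiv.swap 1 2) ∨
    r = leftTree (genN K) (nB K) (nB K) σ - rightTree (genN K) (nB K) (nB K) σ ∨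
    r = leftTree (genN K) (nB K) (nB K) σ
      - leftTree (genN K) (nB K) (nB K) (σ * Equiv.swap 1 2) ∨
    r = leftTree (genN K) (nB K) (nW K) σ - rightTree (genN K) (nB K) (nW K) σ ∨
    r = leftTree (genN K) (nB K) (nW K) σ
      - leftTree (genN K) (nB K) (nW K) (σ * Equiv.swap 1 2) ∨
    r = leftTree (genN K) (nW K) (nB K) σ - rightTree (genN K) (nW K) (nB K) σ ∨
    r = leftTree (genN K) (nW K) (nB K) σ
      - leftTree (genN K) (nW K) (nB K) (σ * Equiv.swap 1 2) ∨
    r = leftTree (genN K) (nB K) (nW K) σ - leftTree (genN K) (nW K) (nB K) σ ∨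
    r = rightTree (genN K) (nB K) (nW K) σ - rightTree (genN K) (nW K) (nB K) σ ∨
    -- associativity of `nY`, which is skew and odd: the plus sign is the Koszul sign of
    -- exchanging two operations of degree `-1`
    r = leftTree (genN K) (nY K) (nY K) σ + rightTree (genN K) (nY K) (nY K) σ ∨
    r = leftTree (genN K) (nY K) (nW K) σ
      - leftTree (genN K) (nW K) (nY K) (σ * Equiv.swap 1 2) ∨
    r = rightTree (genN K) (nW K) (nY K) σ
      - leftTree (genN K) (nW K) (nY K) (σ * Equiv.swap 1 2)
      + leftTree (genN K) (nW K) (nY K) σ ∨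
    r = leftTree (genN K) (nY K) (nB K) σ
      - leftTree (genN K) (nB K) (nY K) (σ * Equiv.swap 1 2) ∨
    r = rightTree (genN K) (nB K) (nY K) σ
      - leftTree (genN K) (nB K) (nY K) (σ * Equiv.swap 1 2)
      + leftTree (genN K) (nB K) (nY K) σ}

/-- The quadratic operad with generators `N` and relations `S`. -/
noncomputable def biNijDual (K : Type u) [Field K] : QuadraticData K where
  gens := genN K
  rels := Submodule.span K (relS K)

/-- The functional on `M` dual to `mY`, an element of `M^∨` of degree `-1`. -/
def dualY (K : Type u) [Field K] : (genM K).czechDual.obj (-1) where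
  toFun := fun m => m.1 ⟨neg_neg 1⟩
  map_add' := fun _ _ => rfl
  map_smul' := fun _ _ => rfl

/-- The functional on `M` taking the coefficient of `mW` in the basis `mY`, `mW`, `(12) mW`,
`mB`, `(12) mB`. -/
def dualW (K : Type u) [Field K] : (genM K).czechDual.obj 0 where
  toFun := fun m => m.2.1 ⟨neg_zero⟩ 1
  map_add' := fun _ _ => rfl
  map_smul' := fun _ _ => rfl

/-- The functional on `M` taking the coefficient of `mB` in the basis `mY`, `mW`, `(12) mW`,
`mB`, `(12) mB`. -/
def dualB (K : Type u) [Field K] : (genM K).czechDual.obj 0 where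
  toFun := fun m => m.2.2 ⟨neg_zero⟩ 1
  map_add' := fun _ _ => rfl
  map_smul' := fun _ _ => rfl

end BiNijenhuis

open BiNijenhuis

/-! Everything reduces to one finite linear-algebra statement in weight two. An isomorphism of
generators induces one of free operads compatible with the embedding of the weight-two part. If it
carries one space of relations onto another, it therefore matches the generated ideals and descends
to the quotients (`QuadraticData.operadIso`). It remains to see that the span of S corresponds to
R^⊥, which is `map_span_relS`.

M(2) and N(2) have five basis vectors each: the bracket, and each product in its two orders. The
weight-two parts thus have 3 · 25 = 75 basis trees `treeM t i j` and `treeN t i j`, and these are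
dual bases for the pairing transported along N ≅ M^∨ (`quadPairing_treeN_treeM`). An element of R^⊥
is then a family of coefficients c(t, i, j) killed by the relations R, the translates modulo 3 of a
few explicit combinations (`IsRelR`). Exchanging the inputs of a vertex costs a sign in N and none
in M. With this sign, S becomes the list `DualRel`.

That S is orthogonal to R says that the integer coefficients of every relation of R satisfy
`DualRel`, a finite check (`dualRel_coeff`).

The converse needs no dimension count. Modulo S all 75 trees are signed sums of 16 of them: nine
with two products, in the colours white-white, black-black or white-black, one with two brackets,
and six with a product at the root and a bracket above. When Σ c(t, i, j) · `treeN t i j` is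
rewritten in these 16 trees, the 16 coefficients are exactly the 16 relations of R evaluated at c:
nine pre-Lie, one Jacobi, six compatibilities. For an element of R^⊥ they vanish, so the element
lies in the span of S (`sum_eq_zero_of_dualRel`). -/

namespace BiNijenhuis

/-! ### Functoriality of free and quadratic operads in their generators -/

section Functoriality

variable {K : Type u} [Field K]

/-- The inverse of an isomorphism of graded `𝕊₂`-modules. -/
def BinModule.Iso.symm {E F : BinModule K} (φ : E.Iso F) : F.Iso E where
  toEquiv := fun d => (φ.toEquiv d).symm
  map_rep := fun d σ x => by
    rw [LinearEquiv.symm_apply_eq, φ.map_rep, LinearEquiv.apply_symm_apply]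

/-- The map on formal operadic expressions induced by an isomorphism of generators. -/
def Pre.map {E F : BinModule K} (φ : E.Iso F) : ∀ {n : ℕ} {d : ℤ}, Pre E n d → Pre F n d
  | _, _, .gen x => .gen (φ.toEquiv _ x)
  | _, _, .one => .one
  | _, _, .zero => .zero
  | _, _, .add a b => .add (a.map φ) (b.map φ)
  | _, _, .smul c a => .smul c (a.map φ)
  | _, _, .act σ a => .act σ (a.map φ)
  | _, _, .comp i e h a b => .comp i e h (a.map φ) (b.map φ)

theorem Pre.map_symm_map {E F : BinModule K} (φ : E.Iso F) {n : ℕ} {d : ℤ} (a : Pre E n d) :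
    (a.map φ).map φ.symm = a := by
  induction a <;> simp_all [Pre.map, BinModule.Iso.symm]

theorem Pre.map_map_symm {E F : BinModule K} (φ : E.Iso F) {n : ℕ} {d : ℤ} (a : Pre F n d) :
    (a.map φ.symm).map φ = a := by
  induction a <;> simp_all [Pre.map, BinModule.Iso.symm]

/-- The defining clauses of the congruence are uniform in the generators, except the three that make
the generators a representation; these hold because φ is linear and equivariant. -/
theorem Rel.map {E F : BinModule K} (φ : E.Iso F) {n : ℕ} {d : ℤ} {a b : Pre E n d}
    (h : Rel E a b) : Rel F (a.map φ) (b.map φ) := by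
  induction h with
  | symm _ ih => exact ih.symm
  | trans _ _ ih₁ ih₂ => exact ih₁.trans ih₂
  | gen_add x y =>
    simp only [Pre.map, map_add]
    exact Rel.gen_add _ _
  | gen_smul c x =>
    simp only [Pre.map, map_smul]
    exact Rel.gen_smul _ _
  | gen_act σ x =>
    simp only [Pre.map, φ.map_rep]
    exact Rel.gen_act _ _
  | comp_act_left σ i e e' h a b H => exact Rel.comp_act_left σ i e e' h _ _ H
  | one_comp i e h τ a H => exact Rel.one_comp i e h τ _ H
  | comp_one i e h τ a H => exact Rel.comp_one i e h τ _ H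
  | comp_assoc i j f e f' e' h₁ h₂ h₃ h₄ a b c H =>
    exact Rel.comp_assoc i j f e f' e' h₁ h₂ h₃ h₄ _ _ _ H
  | comp_comm i k hik f g f' g' h₁ h₂ h₃ h₄ a b c H =>
    exact Rel.comp_comm i k hik f g f' g' h₁ h₂ h₃ h₄ _ _ _ H
  | refl a => exact .refl _
  | add_congr _ _ iha ihb => exact .add_congr iha ihb
  | smul_congr c _ ih => exact .smul_congr c ih
  | act_congr σ _ ih => exact .act_congr σ ih
  | comp_congr i e h _ _ iha ihb => exact .comp_congr i e h iha ihb
  | add_comm a b => exact .add_comm _ _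
  | add_assoc a b c => exact .add_assoc _ _ _
  | zero_add a => exact .zero_add _
  | one_smul a => exact .one_smul _
  | zero_smul a => exact .zero_smul _
  | mul_smul c c' a => exact .mul_smul _ _ _
  | add_smul c c' a => exact .add_smul _ _ _
  | smul_add c a b => exact .smul_add _ _ _
  | act_add σ a b => exact .act_add _ _ _
  | act_smul σ c a => exact .act_smul _ _ _
  | add_comp i e h a a' b => exact .add_comp _ _ _ _ _ _
  | smul_comp i e h c a b => exact .smul_comp _ _ _ _ _ _
  | comp_add i e h a b b' => exact .comp_add _ _ _ _ _ _
  | comp_smul i e h c a b => exact .comp_smul _ _ _ _ _ _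
  | act_one a => exact .act_one _
  | act_mul σ τ a => exact .act_mul _ _ _
  | act_comp i e h τ a b => exact .act_comp _ _ _ _ _ _
  | comp_act_right i e h τ a b => exact .comp_act_right _ _ _ _ _ _

/-- The isomorphism of free operads induced by an isomorphism of generators. -/
def freeIso {E F : BinModule K} (φ : E.Iso F) : (freeOperad E).Iso (freeOperad F) where
  toEquiv := fun n d =>
    { toFun := Quotient.map (Pre.map φ) (fun _ _ h => Rel.map φ h)
      invFun := Quotient.map (Pre.map φ.symm) (fun _ _ h => Rel.map φ.symm h)
      map_add' := by rintro ⟨a⟩ ⟨b⟩; rfl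
      map_smul' := by rintro c ⟨a⟩; rfl
      left_inv := by rintro ⟨a⟩; exact congrArg FreeObj.mk (a.map_symm_map φ)
      right_inv := by rintro ⟨a⟩; exact congrArg FreeObj.mk (a.map_map_symm φ) }
  map_one := rfl
  map_act := by rintro n d σ ⟨a⟩; rfl
  map_comp := by rintro m n k p q r i e h ⟨a⟩ ⟨b⟩; rfl

theorem freeIso_freeGen {E F : BinModule K} (φ : E.Iso F) (d : ℤ) (x : E.obj d) :
    (freeIso φ).toEquiv 2 d (freeGen E d x) = freeGen F d (φ.toEquiv d x) := rfl

/-- The inverse of an isomorphism of graded operads. -/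
def GrOperad.Iso.symm {P Q : GrOperad K} (f : P.Iso Q) : Q.Iso P where
  toEquiv := fun n d => (f.toEquiv n d).symm
  map_one := by rw [LinearEquiv.symm_apply_eq, f.map_one]
  map_act := fun σ a => by
    rw [LinearEquiv.symm_apply_eq, f.map_act, LinearEquiv.apply_symm_apply]
  map_comp := fun i e h a b => by
    rw [LinearEquiv.symm_apply_eq, f.map_comp, LinearEquiv.apply_symm_apply,
      LinearEquiv.apply_symm_apply]

/-- Used for an isomorphism and for its inverse, this gives both inclusions between the generated
ideals. -/
theorem InIdeal.map {P Q : GrOperad K} (f : P.Iso Q) {X : ∀ n d, Set (P.obj n d)}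
    {Y : ∀ n d, Set (Q.obj n d)} (hXY : ∀ n d, ∀ a ∈ X n d, f.toEquiv n d a ∈ Y n d)
    {n : ℕ} {d : ℤ} {a : P.obj n d} (ha : InIdeal P X a) : InIdeal Q Y (f.toEquiv n d a) := by
  induction ha with
  | of a h => exact .of _ (hXY _ _ a h)
  | zero => rw [map_zero]; exact .zero
  | add a b _ _ iha ihb => rw [map_add]; exact .add _ _ iha ihb
  | smul c a _ ih => rw [map_smul]; exact .smul _ _ ih
  | act σ a _ ih => rw [f.map_act]; exact .act _ _ ih
  | comp_left i e h a b _ ih => rw [f.map_comp]; exact .comp_left _ _ _ _ _ ih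
  | comp_right i e h a b _ ih => rw [f.map_comp]; exact .comp_right _ _ _ _ _ ih

/-- An isomorphism of operads identifying two families of relators induces an isomorphism of
the quotients. -/
def GrOperad.Iso.quot {P Q : GrOperad K} (f : P.Iso Q) (X : ∀ n d, Set (P.obj n d))
    (Y : ∀ n d, Set (Q.obj n d)) (hXY : ∀ n d, ∀ a ∈ X n d, f.toEquiv n d a ∈ Y n d)
    (hYX : ∀ n d, ∀ b ∈ Y n d, (f.toEquiv n d).symm b ∈ X n d) :
    (P.quot X).Iso (Q.quot Y) where
  toEquiv := fun n d => Submodule.Quotient.equiv (genIdeal P X n d) (genIdeal Q Y n d)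
    (f.toEquiv n d) (by
      apply le_antisymm
      · rintro _ ⟨a, ha, rfl⟩
        exact InIdeal.map f hXY ha
      · intro b hb
        exact ⟨_, InIdeal.map f.symm hYX hb, (f.toEquiv n d).apply_symm_apply b⟩)
  map_one := congrArg Submodule.Quotient.mk f.map_one
  map_act := by
    intro n d σ a
    obtain ⟨a, rfl⟩ := Submodule.Quotient.mk_surjective _ a
    exact congrArg Submodule.Quotient.mk (f.map_act σ a)
  map_comp := by
    intro m n k p q r i e h a b
    obtain ⟨a, rfl⟩ := Submodule.Quotient.mk_surjective _ a
    obtain ⟨b, rfl⟩ := Submodule.Quotient.mk_surjective _ b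
    exact congrArg Submodule.Quotient.mk (f.map_comp i e h a b)

/-- Naturality of the embedding of two-vertex trees: both sides are additive, and on one tree they
are the composite of the transported generators. It carries the relators of one presentation to
those of the other. -/
theorem quadEval_quadMap {E F : BinModule K} (φ : E.Iso F) (r : Quad E) (d : ℤ) :
    quadEval F (quadMap φ r) d = (freeIso φ).toEquiv 3 d (quadEval E r d) := by
  have key : (quadEval F).comp (quadMap φ) =
      (DirectSum.lmap fun d => ((freeIso φ).toEquiv 3 d).toLinearMap).comp (quadEval E) := by
    refine DirectSum.linearMap_ext _ fun s => TensorProduct.ext' fun x y => ?_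
    simp only [LinearMap.comp_apply, quadMap, quadEval, DirectSum.lmap_lof,
      DirectSum.toModule_lof, TensorProduct.map_tmul, TensorProduct.lift.tmul,
      LinearMap.compl₁₂_apply, LinearEquiv.coe_coe, ← freeIso_freeGen, (freeIso φ).map_comp]
  exact congrArg (fun g : ⨁ d, (freeOperad F).obj 3 d => g d) (LinearMap.congr_fun key r)

/-- An isomorphism of generators identifying the relations induces an isomorphism of quadratic
operads. -/
noncomputable def QuadraticData.operadIso (C D : QuadraticData K) (φ : C.gens.Iso D.gens)
    (h : C.rels.map (quadMap φ) = D.rels) : C.operad.Iso D.operad :=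
  (freeIso φ).quot C.relators D.relators
    (by
      rintro n d a ha
      unfold QuadraticData.relators at ha ⊢
      split at ha
      · obtain ⟨r, hr, rfl⟩ := ha
        exact ⟨quadMap φ r, h ▸ Submodule.mem_map_of_mem hr, quadEval_quadMap φ r _⟩
      · exact ha.elim)
    (by
      rintro n d b hb
      unfold QuadraticData.relators at hb ⊢
      split at hb
      · obtain ⟨r, hr, rfl⟩ := hb
        rw [← h] at hr
        obtain ⟨r, hr, rfl⟩ := hr
        exact ⟨r, hr, by rw [quadEval_quadMap, LinearEquiv.symm_apply_apply]⟩
      · exact hb.elim)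

theorem QuadraticData.operadIso_gen (C D : QuadraticData K) (φ : C.gens.Iso D.gens)
    (h : C.rels.map (quadMap φ) = D.rels) (d : ℤ) (x : C.gens.obj d) :
    (C.operadIso D φ h).toEquiv 2 d (C.gen x) = D.gen (φ.toEquiv d x) := rfl

end Functoriality

/-! ### The isomorphism between N and the dual of M -/

section Duality

variable {K : Type u} [Field K]

/-- The dual of a space placed in degree `d₀` is the dual space placed in degree `-d₀`. -/
noncomputable def inDegreeDual {V W : Type u} [AddCommGroup V] [Module K V] [AddCommGroup W]
    [Module K W] (e : V ≃ₗ[K] Module.Dual K W) {P Q : Prop} [Decidable Q] (h : Q ↔ P) :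
    (PLift P → V) ≃ₗ[K] Module.Dual K (PLift Q → W) :=
  (LinearEquiv.funCongrLeft K V (Equiv.plift.trans ((Equiv.ofIff h).trans Equiv.plift.symm))).trans
    ((LinearEquiv.piCongrRight fun _ => e).trans (LinearMap.lsum K (fun _ : PLift Q => W) K))

/-- The index type is a subsingleton, so the sum has one term in the right degree and none
elsewhere. This form treats all degrees at once, as equivariance requires. -/
theorem inDegreeDual_apply {V W : Type u} [AddCommGroup V] [Module K V] [AddCommGroup W]
    [Module K W] (e : V ≃ₗ[K] Module.Dual K W) {P Q : Prop} [Decidable Q] (h : Q ↔ P)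
    (f : PLift P → V) (m : PLift Q → W) :
    inDegreeDual e h f m = ∑ x : PLift Q, e (f ⟨h.1 x.down⟩) (m x) := by
  simp [inDegreeDual, LinearMap.lsum_apply, LinearEquiv.funCongrLeft_apply]

/-- The isomorphism of `K[𝕊₂]` with its dual given by the basis of group elements. -/
noncomputable def regularDual (K : Type u) [Field K] :
    (Equiv.Perm (Fin 2) → K) ≃ₗ[K] Module.Dual K (Equiv.Perm (Fin 2) → K) :=
  (LinearEquiv.piRing K K (Equiv.Perm (Fin 2)) K).symm

theorem regularDual_apply (f g : Equiv.Perm (Fin 2) → K) :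
    regularDual K f g = ∑ τ, f τ * g τ := by
  simp [regularDual, LinearEquiv.piRing_symm_apply, mul_comm]

/-- Group elements form an orthonormal basis permuted by the group. Reindexing the sum by τ ↦ στ
moves σ to the other argument as σ⁻¹, and the sign is that of the twist. -/
theorem regularDual_rep (σ : Equiv.Perm (Fin 2)) (f g : Equiv.Perm (Fin 2) → K) :
    regularDual K (sgnTwist (regular K) σ f) g =
      (((Equiv.Perm.sign σ : ℤˣ) : ℤ) : K) * regularDual K f (regular K σ⁻¹ g) := by
  rw [regularDual_apply, regularDual_apply, Finset.mul_sum,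
    ← Equiv.sum_comp (Equiv.mulLeft σ)]
  simp [sgnTwist, regular, LinearMap.funLeft_apply, mul_assoc]

theorem inDegreeDual_of_true {V W : Type u} [AddCommGroup V] [Module K V] [AddCommGroup W]
    [Module K W] (e : V ≃ₗ[K] Module.Dual K W) {P Q : Prop} [Decidable Q] (h : Q ↔ P) (q : Q)
    (f : PLift P → V) (m : PLift Q → W) :
    inDegreeDual e h f m = e (f ⟨h.1 q⟩) (m ⟨q⟩) := by
  rw [inDegreeDual_apply]
  exact Fintype.sum_eq_single _ fun x hx => (hx rfl).elim

theorem inDegreeDual_of_false {V W : Type u} [AddCommGroup V] [Module K V] [AddCommGroup W]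
    [Module K W] (e : V ≃ₗ[K] Module.Dual K W) {P Q : Prop} [Decidable Q] (h : Q ↔ P) (q : ¬Q)
    (f : PLift P → V) (m : PLift Q → W) :
    inDegreeDual e h f m = 0 := by
  rw [inDegreeDual_apply]
  exact Fintype.sum_eq_zero _ fun x => (q x.down).elim

theorem inDegreeDual_equivariant {V W : Type u} [AddCommGroup V] [Module K V]
    [AddCommGroup W] [Module K W] (e : V ≃ₗ[K] Module.Dual K W) {P Q : Prop} [Decidable Q]
    (h : Q ↔ P) {A : V → V} {B : W → W} {c : K} (he : ∀ v w, e (A v) w = c * e v (B w))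
    (f : PLift P → V) (m : PLift Q → W) :
    inDegreeDual e h (fun x => A (f x)) m = c * inDegreeDual e h f (fun x => B (m x)) := by
  simp only [inDegreeDual_apply, Finset.mul_sum, he]

/-- The field as its own dual. -/
noncomputable def scalarDual (K : Type u) [Field K] : K ≃ₗ[K] Module.Dual K K :=
  (LinearMap.ringLmapEquivSelf K K K).symm

theorem scalarDual_apply (a b : K) : scalarDual K a b = b * a := by
  simp [scalarDual]

theorem scalarDual_rep (σ : Equiv.Perm (Fin 2)) (a b : K) :
    scalarDual K (sgnTwist (Representation.trivial K (Equiv.Perm (Fin 2)) K) σ a) b =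
      (((Equiv.Perm.sign σ : ℤˣ) : ℤ) : K) *
        scalarDual K a (Representation.trivial K (Equiv.Perm (Fin 2)) K σ⁻¹ b) := by
  simp [sgnTwist, scalarDual_apply, mul_left_comm]

/-- The isomorphism of graded `𝕊`-modules `N ≅ M^∨`. -/
noncomputable def dualIso (K : Type u) [Field K] : (genN K).Iso (genM K).czechDual where
  toEquiv := fun d =>
    ((inDegreeDual (scalarDual K) neg_eq_iff_eq_neg).prodCongr
      ((inDegreeDual (regularDual K) neg_eq_zero).prodCongr
        (inDegreeDual (regularDual K) neg_eq_zero))).trans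
      (((LinearEquiv.refl K _).prodCongr (LinearMap.coprodEquiv K)).trans
        (LinearMap.coprodEquiv K))
  map_rep := by
    rintro d σ ⟨x, y, z⟩
    refine LinearMap.ext ?_
    rintro ⟨m, n, l⟩
    -- The sign of the Czech dual is distributed over the three summands of the evaluation, so that
    -- equivariance can be checked on each of them.
    refine Eq.trans ?_ ((mul_add _ _ _).trans (congrArg _ (mul_add _ _ _))).symm
    exact congrArg₂ (· + ·) (inDegreeDual_equivariant _ _ (scalarDual_rep σ) x m)
      (congrArg₂ (· + ·) (inDegreeDual_equivariant _ _ (regularDual_rep σ) y n)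
        (inDegreeDual_equivariant _ _ (regularDual_rep σ) z l))

/-- The value of an element of `E^∨` of degree `d` on an element of `E` of degree `-d`. -/
def BinModule.eval (E : BinModule K) {d : ℤ} (f : E.czechDual.obj d) (x : E.obj (-d)) : K :=
  (show Module.Dual K (E.obj (-d)) from f) x

theorem dualIso_eval (d : ℤ) (x : (genN K).obj d) (m : (genM K).obj (-d)) :
    (genM K).eval ((dualIso K).toEquiv d x) m =
      inDegreeDual (scalarDual K) neg_eq_iff_eq_neg x.1 m.1 +
        (inDegreeDual (regularDual K) neg_eq_zero x.2.1 m.2.1 +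
          inDegreeDual (regularDual K) neg_eq_zero x.2.2 m.2.2) := rfl

/-- In this degree only the bracket contributes, the products being concentrated in degree 0. -/
theorem dualIso_eval_odd (x : (genN K).obj (-1)) (m : (genM K).obj (- -1)) :
    (genM K).eval ((dualIso K).toEquiv (-1) x) m = m.1 ⟨neg_neg 1⟩ * x.1 ⟨rfl⟩ := by
  refine (dualIso_eval _ _ _).trans ?_
  refine (congrArg₂ (· + ·) (inDegreeDual_of_true _ _ (neg_neg 1) _ _)
    (congrArg₂ (· + ·) (inDegreeDual_of_false _ _ (by decide) _ _)
      (inDegreeDual_of_false _ _ (by decide) _ _))).trans ?_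
  rw [add_zero, add_zero, scalarDual_apply]

theorem dualIso_eval_even (x : (genN K).obj 0) (m : (genM K).obj (-0)) :
    (genM K).eval ((dualIso K).toEquiv 0 x) m =
      regularDual K (x.2.1 ⟨rfl⟩) (m.2.1 ⟨neg_zero⟩) +
        regularDual K (x.2.2 ⟨rfl⟩) (m.2.2 ⟨neg_zero⟩) := by
  refine (dualIso_eval _ _ _).trans ?_
  refine (congrArg₂ (· + ·) (inDegreeDual_of_false _ _ (by decide) _ _)
    (congrArg₂ (· + ·) (inDegreeDual_of_true _ _ neg_zero _ _)
      (inDegreeDual_of_true _ _ neg_zero _ _))).trans ?_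
  exact zero_add _

theorem regularDual_regOne (f : Equiv.Perm (Fin 2) → K) :
    regularDual K (regOne K) f = f 1 := by
  simp [regularDual_apply, regOne, Pi.single_apply]

theorem dualIso_nY : (dualIso K).toEquiv (-1) (nY K) = dualY K :=
  LinearMap.ext fun _ => (dualIso_eval_odd _ _).trans (mul_one _)

theorem dualIso_nW : (dualIso K).toEquiv 0 (nW K) = dualW K := by
  refine LinearMap.ext fun m => (dualIso_eval_even _ _).trans ?_
  refine (congrArg₂ (· + ·) (regularDual_regOne _)
    (LinearMap.congr_fun (map_zero (regularDual K)) _)).trans ?_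
  exact add_zero _

theorem dualIso_nB : (dualIso K).toEquiv 0 (nB K) = dualB K := by
  refine LinearMap.ext fun m => (dualIso_eval_even _ _).trans ?_
  refine (congrArg₂ (· + ·) (LinearMap.congr_fun (map_zero (regularDual K)) _)
    (regularDual_regOne _)).trans ?_
  exact zero_add _

/-! ### Dual bases of two-vertex trees -/

/-- Labels of the basis vectors of `M(2)` and `N(2)`: `none` is the operation of odd degree,
`some (x, s)` is the product of colour `x` (white if `x = false`) with its arguments exchanged
if `s = true`. -/
abbrev Gen : Type := Option (Bool × Bool)

/-- The label of the operation with its arguments exchanged. -/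
def Gen.opp : Gen → Gen
  | none => none
  | some (x, s) => some (x, !s)

/-- The degree of a basis vector of `N(2)`. -/
def Gen.deg : Gen → ℤ
  | none => -1
  | some _ => 0

/-- The basis vector of `K[𝕊₂]` given by the identity or the transposition. -/
def regVec (K : Type u) [Field K] (s : Bool) : Equiv.Perm (Fin 2) → K :=
  Pi.single (if s then Equiv.swap 0 1 else 1) 1

/-- The basis of `N(2)`. -/
def basisN (K : Type u) [Field K] : ∀ i : Gen, (genN K).obj i.deg
  | none => nY K
  | some (false, s) => (fun _ => 0, fun _ => regVec K s, fun _ => 0)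
  | some (true, s) => (fun _ => 0, fun _ => 0, fun _ => regVec K s)

/-- The basis of `M(2)`. -/
def basisM (K : Type u) [Field K] : ∀ i : Gen, (genM K).obj (-i.deg)
  | none => mY K
  | some (false, s) => (fun _ => 0, fun _ => regVec K s, fun _ => 0)
  | some (true, s) => (fun _ => 0, fun _ => 0, fun _ => regVec K s)

theorem regular_swap_regVec (s : Bool) :
    regular K (Equiv.swap 0 1) (regVec K s) = regVec K (!s) := by
  have h : ∀ τ : Equiv.Perm (Fin 2), (Equiv.swap 0 1 * τ =
      if s then Equiv.swap 0 1 else 1) ↔ τ = if s = false then Equiv.swap 0 1 else 1 := by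
    revert s; decide
  ext τ
  simp [regular, regVec, LinearMap.funLeft_apply, Pi.single_apply, h]

theorem regularDual_regVec (s s' : Bool) :
    regularDual K (regVec K s) (regVec K s') = if s = s' then 1 else 0 := by
  have h : ((if s' then Equiv.swap 0 1 else 1 : Equiv.Perm (Fin 2)) =
      if s then Equiv.swap 0 1 else 1) ↔ s = s' := by
    revert s s'; decide
  simp [regularDual_apply, regVec, Pi.single_apply, h]

theorem dualIso_basisN_none :
    (genM K).eval ((dualIso K).toEquiv _ (basisN K none)) (basisM K none) = 1 :=
  (dualIso_eval_odd _ _).trans (mul_one _)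

theorem dualIso_basisN_some (a b : Bool × Bool) :
    (genM K).eval ((dualIso K).toEquiv _ (basisN K (some a))) (basisM K (some b)) =
      if a = b then 1 else 0 := by
  obtain ⟨x, s⟩ := a
  obtain ⟨y, s'⟩ := b
  refine (dualIso_eval_even _ _).trans ?_
  cases x <;> cases y <;> simp [basisN, basisM, regularDual_regVec]

theorem quadPairing_quadMap_lof {E F : BinModule K} (φ : F.Iso E.czechDual)
    (s s' : Fin 3 × ℤ × ℤ) (x : F.obj s.2.1) (y : F.obj s.2.2)
    (v : E.obj s'.2.1 ⊗[K] E.obj s'.2.2) :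
    quadPairing E (quadMap φ (DirectSum.lof K (Fin 3 × ℤ × ℤ)
        (fun s => F.obj s.2.1 ⊗[K] F.obj s.2.2) s (x ⊗ₜ y)))
      (DirectSum.lof K (Fin 3 × ℤ × ℤ)
        (fun s => E.obj s.2.1 ⊗[K] E.obj s.2.2) s' v) =
      TensorProduct.dualDistrib K (E.obj (-s.2.1)) (E.obj (-s.2.2))
        (φ.toEquiv _ x ⊗ₜ φ.toEquiv _ y)
        (DirectSum.component K (Fin 3 × ℤ × ℤ)
          (fun s => E.obj s.2.1 ⊗[K] E.obj s.2.2) (s.1, -s.2.1, -s.2.2)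
          (DirectSum.lof K (Fin 3 × ℤ × ℤ)
            (fun s => E.obj s.2.1 ⊗[K] E.obj s.2.2) s' v)) := by
  rw [quadMap, DirectSum.lmap_lof, quadPairing]
  erw [DirectSum.toModule_lof]
  rfl

theorem quadPairing_quadMap_lof_self {E F : BinModule K} (φ : F.Iso E.czechDual) (t : Fin 3)
    {p q : ℤ} (x : F.obj p) (y : F.obj q) (m : E.obj (-p)) (n : E.obj (-q)) :
    quadPairing E (quadMap φ (DirectSum.lof K (Fin 3 × ℤ × ℤ)
        (fun s => F.obj s.2.1 ⊗[K] F.obj s.2.2) (t, p, q) (x ⊗ₜ y)))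
      (DirectSum.lof K (Fin 3 × ℤ × ℤ)
        (fun s => E.obj s.2.1 ⊗[K] E.obj s.2.2) (t, -p, -q) (m ⊗ₜ n)) =
      E.eval (φ.toEquiv p x) m * E.eval (φ.toEquiv q y) n := by
  refine (quadPairing_quadMap_lof φ (t, p, q) _ x y _).trans ?_
  rw [DirectSum.component.lof_self]
  exact TensorProduct.dualDistrib_apply _ _ _ _

theorem quadPairing_quadMap_lof_of_ne {E F : BinModule K} (φ : F.Iso E.czechDual)
    {s s' : Fin 3 × ℤ × ℤ} (h : s' ≠ (s.1, -s.2.1, -s.2.2)) (x : F.obj s.2.1)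
    (y : F.obj s.2.2) (v : E.obj s'.2.1 ⊗[K] E.obj s'.2.2) :
    quadPairing E (quadMap φ (DirectSum.lof K (Fin 3 × ℤ × ℤ)
        (fun s => F.obj s.2.1 ⊗[K] F.obj s.2.2) s (x ⊗ₜ y)))
      (DirectSum.lof K (Fin 3 × ℤ × ℤ)
        (fun s => E.obj s.2.1 ⊗[K] E.obj s.2.2) s' v) = 0 := by
  rw [quadPairing_quadMap_lof, DirectSum.component.of, dif_neg h, map_zero]

/-- The basis of the weight two part of `𝓕(N)`. -/
noncomputable def treeN (K : Type u) [Field K] (t : Fin 3) (i j : Gen) : Quad (genN K) :=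
  DirectSum.lof K (Fin 3 × ℤ × ℤ) (fun s => (genN K).obj s.2.1 ⊗[K] (genN K).obj s.2.2)
    (t, i.deg, j.deg) (basisN K i ⊗ₜ[K] basisN K j)

/-- The basis of the weight two part of `𝓕(M)`. -/
noncomputable def treeM (K : Type u) [Field K] (t : Fin 3) (i j : Gen) : Quad (genM K) :=
  DirectSum.lof K (Fin 3 × ℤ × ℤ) (fun s => (genM K).obj s.2.1 ⊗[K] (genM K).obj s.2.2)
    (t, -i.deg, -j.deg) (basisM K i ⊗ₜ[K] basisM K j)

/-- Trees with different root labels or degrees lie in different components and are orthogonal.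
Otherwise the pairing is a product of two evaluations of dual bases of generators. -/
theorem quadPairing_treeN_treeM (t t' : Fin 3) (i j i' j' : Gen) :
    quadPairing (genM K) (quadMap (dualIso K) (treeN K t i j)) (treeM K t' i' j') =
      if t = t' ∧ i = i' ∧ j = j' then 1 else 0 := by
  by_cases h : (t', -i'.deg, -j'.deg) = (t, -i.deg, -j.deg)
  · simp only [Prod.mk.injEq, neg_inj] at h
    obtain ⟨rfl, hi, hj⟩ := h
    -- Equal degrees force both labels to be the odd operation or both to be products; the mixed
    -- cases are discarded by arithmetic.
    rcases i with _ | i <;> rcases i' with _ | i' <;> simp only [Gen.deg] at hi <;> try omega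
    all_goals rcases j with _ | j <;> rcases j' with _ | j' <;>
      simp only [Gen.deg] at hj <;> try omega
    all_goals refine (quadPairing_quadMap_lof_self (dualIso K) _ _ _ _ _).trans ?_
    · refine (congrArg₂ (· * ·) dualIso_basisN_none dualIso_basisN_none).trans ?_
      simp
    · refine (congrArg₂ (· * ·) dualIso_basisN_none (dualIso_basisN_some _ _)).trans ?_
      simp
    · refine (congrArg₂ (· * ·) (dualIso_basisN_some _ _) dualIso_basisN_none).trans ?_
      simp
    · refine (congrArg₂ (· * ·) (dualIso_basisN_some _ _) (dualIso_basisN_some _ _)).trans ?_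
      simp [← ite_and, and_comm]
  · refine (quadPairing_quadMap_lof_of_ne (dualIso K) (s := (t, i.deg, j.deg)) h _ _ _).trans ?_
    rw [if_neg]
    rintro ⟨rfl, rfl, rfl⟩
    exact h rfl

theorem regVec_span (f : Equiv.Perm (Fin 2) → K) :
    f = f 1 • regVec K false + f (Equiv.swap 0 1) • regVec K true := by
  have h : ∀ τ : Equiv.Perm (Fin 2), τ = 1 ∧ τ ≠ Equiv.swap 0 1 ∨
    τ = Equiv.swap 0 1 ∧ τ ≠ 1 := by decide
  ext τ
  rcases h τ with ⟨rfl, h⟩ | ⟨rfl, h⟩ <;> simp [regVec, h]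

/-- The basis vectors span N(2) in every degree. The induction runs over all degrees together
because the basis vectors live in different ones. -/
theorem genN_induction {P : ∀ d : ℤ, (genN K).obj d → Prop} (h0 : ∀ d, P d 0)
    (hadd : ∀ d x y, P d x → P d y → P d (x + y)) (hsmul : ∀ d (c : K) x, P d x → P d (c • x))
    (hb : ∀ i, P _ (basisN K i)) (d : ℤ) (x : (genN K).obj d) : P d x := by
  obtain ⟨x, y, z⟩ := x
  -- These identities handle the zero components when a white or black element is expanded in its
  -- two basis vectors.
  have z1 : ∀ {c c' : K}, c • (0 : Equiv.Perm (Fin 2) → K) + c' • 0 = 0 := by simp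
  have z2 : ∀ {c c' : K}, c • (0 : K) + c' • (0 : K) = 0 := by simp
  have hp : ∀ (a b : K) (u v : (genN K).obj 0), P 0 u → P 0 v → P 0 (a • u + b • v) :=
    fun a b u v hu hv => hadd _ _ _ (hsmul _ _ _ hu) (hsmul _ _ _ hv)
  have hx : P d (x, 0, 0) := by
    by_cases hd : d = -1
    · subst hd
      have e : ((x, 0, 0) : (genN K).obj (-1)) = x ⟨rfl⟩ • basisN K none :=
        Prod.ext (funext fun _ => (mul_one _).symm) (smul_zero _).symm
      exact e ▸ hsmul _ _ _ (hb none)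
    · have e : ((x, 0, 0) : (genN K).obj d) = 0 :=
        Prod.ext (funext fun h => (hd h.down).elim) rfl
      exact e ▸ h0 d
  have hy : P d (0, y, 0) := by
    by_cases hd : d = 0
    · subst hd
      exact Eq.subst (motive := P 0) (Prod.ext (funext fun _ => z2) (Prod.ext
        (funext fun _ => (regVec_span _).symm) (funext fun _ => z1)))
        (hp (y ⟨rfl⟩ 1) (y ⟨rfl⟩ (Equiv.swap 0 1)) _ _ (hb (some (false, false)))
          (hb (some (false, true))))
    · have e : ((0, y, 0) : (genN K).obj d) = 0 :=
        Prod.ext rfl (Prod.ext (funext fun h => (hd h.down).elim) rfl)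
      exact e ▸ h0 d
  have hz : P d (0, 0, z) := by
    by_cases hd : d = 0
    · subst hd
      exact Eq.subst (motive := P 0) (Prod.ext (funext fun _ => z2) (Prod.ext
        (funext fun _ => z1) (funext fun _ => (regVec_span _).symm)))
        (hp (z ⟨rfl⟩ 1) (z ⟨rfl⟩ (Equiv.swap 0 1)) _ _ (hb (some (true, false)))
          (hb (some (true, true))))
    · have e : ((0, 0, z) : (genN K).obj d) = 0 :=
        Prod.ext rfl (Prod.ext rfl (funext fun h => (hd h.down).elim))
      exact e ▸ h0 d
  have e : ((x, y, z) : (genN K).obj d) = (x, 0, 0) + (0, y, 0) + (0, 0, z) :=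
    Prod.ext ((add_zero _).trans (add_zero _)).symm
      (Prod.ext ((add_zero _).trans (zero_add _)).symm
        ((congrArg (· + z) (add_zero _)).trans (zero_add _)).symm)
  exact e ▸ hadd _ _ _ (hadd _ _ _ hx hy) hz

theorem linearMap_ext_treeN {Q : Type*} [AddCommGroup Q] [Module K Q]
    {f g : Quad (genN K) →ₗ[K] Q} (h : ∀ t i j, f (treeN K t i j) = g (treeN K t i j)) :
    f = g := by
  refine DirectSum.linearMap_ext _ fun ⟨t, p, q⟩ => TensorProduct.ext' fun x y => ?_
  change (genN K).obj p at x
  change (genN K).obj q at y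
  induction p, x using genN_induction with
  | h0 d => simp only [TensorProduct.zero_tmul, map_zero]
  | hadd d x x' hx hx' => simp only [TensorProduct.add_tmul, map_add, hx, hx']
  | hsmul d c x hx => simp only [← TensorProduct.smul_tmul', map_smul, hx]
  | hb i =>
    induction q, y using genN_induction with
    | h0 d => simp only [TensorProduct.tmul_zero, map_zero]
    | hadd d x x' hx hx' => simp only [TensorProduct.tmul_add, map_add, hx, hx']
    | hsmul d c x hx => simp only [TensorProduct.tmul_smul, map_smul, hx]
    | hb j => exact h t i j

/-- Reconstruction from the dual basis: both sides are linear in f, so orthonormality on the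
spanning trees suffices. -/
theorem sum_treeN (f : Quad (genN K)) :
    ∑ t, ∑ i, ∑ j, quadPairing (genM K) (quadMap (dualIso K) f) (treeM K t i j) • treeN K t i j =
      f := by
  have key : ∑ t, ∑ i, ∑ j, (((quadPairing (genM K)).comp (quadMap (dualIso K))).flip
      (treeM K t i j)).smulRight (treeN K t i j) = LinearMap.id := by
    refine linearMap_ext_treeN fun t i j => ?_
    simp only [LinearMap.sum_apply, LinearMap.smulRight_apply, LinearMap.flip_apply,
      LinearMap.comp_apply, quadPairing_treeN_treeM, ite_and, ite_smul, one_smul, zero_smul,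
      Finset.sum_ite_eq, Finset.sum_ite_irrel, Finset.sum_const_zero, Finset.mem_univ, if_true,
      LinearMap.id_apply]
  simpa [LinearMap.sum_apply] using LinearMap.congr_fun key f

end Duality

/-! ### Trees with permuted leaves in terms of the basis -/

section Trees

variable {K : Type u} [Field K]

/-- The symmetric group on ℤ/3 consists of the translations x ↦ x + a, which are the even
permutations, and the reflections x ↦ a - x, which are the odd ones. Relabelling thus becomes
arithmetic modulo 3. -/
theorem perm_three_cases (σ : Equiv.Perm (Fin 3)) :
    (∃ a, σ = Equiv.addRight a) ∨ ∃ a, σ = Equiv.subLeft a := by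
  revert σ; decide

theorem sign_addRight_three (a : Fin 3) : Equiv.Perm.sign (Equiv.addRight a) = 1 := by
  revert a; decide

theorem sign_subLeft_three (a : Fin 3) : Equiv.Perm.sign (Equiv.subLeft a) ≠ 1 := by
  revert a; decide

theorem addRight_mul_finRotate (a : Fin 3) :
    (Equiv.addRight a : Equiv.Perm (Fin 3)) * finRotate 3 = Equiv.addRight (a + 1) := by
  revert a; decide

theorem subLeft_mul_finRotate (a : Fin 3) :
    (Equiv.subLeft a : Equiv.Perm (Fin 3)) * finRotate 3 = Equiv.subLeft (a - 1) := by
  revert a; decide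

theorem addRight_mul_swap_one_two (a : Fin 3) :
    (Equiv.addRight a : Equiv.Perm (Fin 3)) * Equiv.swap 1 2 = Equiv.subLeft a := by
  revert a; decide

theorem subLeft_mul_swap_one_two (a : Fin 3) :
    (Equiv.subLeft a : Equiv.Perm (Fin 3)) * Equiv.swap 1 2 = Equiv.addRight a := by
  revert a; decide

theorem addRight_mul_swap_zero_one (a : Fin 3) :
    (Equiv.addRight a : Equiv.Perm (Fin 3)) * Equiv.swap 0 1 = Equiv.subLeft (a + 1) := by
  revert a; decide

theorem subLeft_mul_swap_zero_one (a : Fin 3) :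
    (Equiv.subLeft a : Equiv.Perm (Fin 3)) * Equiv.swap 0 1 = Equiv.addRight (a - 1) := by
  revert a; decide

theorem leftTree_addRight (E : BinModule K) {p q : ℤ} (x : E.obj p) (y : E.obj q) (a : Fin 3) :
    leftTree E x y (Equiv.addRight a) =
      DirectSum.lof K (Fin 3 × ℤ × ℤ) (fun s => E.obj s.2.1 ⊗[K] E.obj s.2.2) (2 + a, p, q)
        (x ⊗ₜ[K] y) := by
  rw [leftTree, if_pos (sign_addRight_three a)]
  rfl

theorem leftTree_subLeft (E : BinModule K) {p q : ℤ} (x : E.obj p) (y : E.obj q) (a : Fin 3) :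
    leftTree E x y (Equiv.subLeft a) =
      DirectSum.lof K (Fin 3 × ℤ × ℤ) (fun s => E.obj s.2.1 ⊗[K] E.obj s.2.2) (a - 2, p, q)
        (x ⊗ₜ[K] E.rep q (Equiv.swap 0 1) y) := by
  rw [leftTree, if_neg (sign_subLeft_three a)]
  rfl

/-- The tree `x(y(t + 1, t + 2), t)` as a bilinear function of its decorations. -/
noncomputable def lofTree (E : BinModule K) (t : Fin 3) (p q : ℤ) :
    E.obj p →ₗ[K] E.obj q →ₗ[K] Quad E :=
  (TensorProduct.mk K (E.obj p) (E.obj q)).compr₂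
    (DirectSum.lof K (Fin 3 × ℤ × ℤ) (fun s => E.obj s.2.1 ⊗[K] E.obj s.2.2) (t, p, q))

theorem sgnTwist_swap {V : Type u} [AddCommGroup V] [Module K V]
    (ρ : Representation K (Equiv.Perm (Fin 2)) V) (v : V) :
    sgnTwist ρ (Equiv.swap 0 1) v = -ρ (Equiv.swap 0 1) v := by
  simp [sgnTwist]

theorem rep_swap_nY : (genN K).rep (-1) (Equiv.swap 0 1) (nY K) = -nY K :=
  Prod.ext (funext fun _ => sgnTwist_swap (Representation.trivial K (Equiv.Perm (Fin 2)) K) 1)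
    (Prod.ext (funext fun h => absurd h.down (by decide))
      (funext fun h => absurd h.down (by decide)))

theorem rep_swap_basisN_some (x s : Bool) :
    (genN K).rep 0 (Equiv.swap 0 1) (basisN K (some (x, s))) =
      -(show (genN K).obj 0 from basisN K (some (x, !s))) := by
  have h : ∀ s, sgnTwist (regular K) (Equiv.swap 0 1) (regVec K s) = -regVec K (!s) := fun s => by
    rw [sgnTwist_swap, regular_swap_regVec]
  have h0 : sgnTwist (regular K) (Equiv.swap 0 1) 0 = -0 := by rw [map_zero, neg_zero]
  cases x
  · exact Prod.ext (funext fun h => absurd h.down (by decide))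
      (Prod.ext (funext fun _ => h s) (funext fun _ => h0))
  · exact Prod.ext (funext fun h => absurd h.down (by decide))
      (Prod.ext (funext fun _ => h0) (funext fun _ => h s))

theorem rep_swap_mY : (genM K).rep 1 (Equiv.swap 0 1) (mY K) = mY K :=
  Prod.ext rfl (Prod.ext (funext fun h => absurd h.down (by decide))
      (funext fun h => absurd h.down (by decide)))

theorem rep_swap_basisM_some (x s : Bool) :
    (genM K).rep 0 (Equiv.swap 0 1) (basisM K (some (x, s))) =
      (show (genM K).obj 0 from basisM K (some (x, !s))) := by
  have h0 : regular K (Equiv.swap 0 1) 0 = 0 := map_zero _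
  cases x
  · exact Prod.ext (funext fun h => absurd h.down (by decide))
      (Prod.ext (funext fun _ => regular_swap_regVec s) (funext fun _ => h0))
  · exact Prod.ext (funext fun h => absurd h.down (by decide))
      (Prod.ext (funext fun _ => h0) (funext fun _ => regular_swap_regVec s))

/-- The bracket of N is skew and the products carry the sign twist, so exchanging inputs always
costs a sign here; the analogues for M have none. -/
theorem lofTree_rep_right_basisN (t : Fin 3) {p : ℤ} (x : (genN K).obj p) (j : Gen) :
    lofTree (genN K) t p j.deg x ((genN K).rep _ (Equiv.swap 0 1) (basisN K j)) =
      -lofTree (genN K) t p j.opp.deg x (basisN K j.opp) := by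
  rcases j with _ | ⟨y, s⟩
  · exact (congrArg (lofTree (genN K) t p (-1) x) rep_swap_nY).trans (map_neg _ _)
  · exact (congrArg (lofTree (genN K) t p 0 x) (rep_swap_basisN_some y s)).trans (map_neg _ _)

theorem lofTree_rep_left_basisN (t : Fin 3) {q : ℤ} (i : Gen) (y : (genN K).obj q) :
    lofTree (genN K) t i.deg q ((genN K).rep _ (Equiv.swap 0 1) (basisN K i)) y =
      -lofTree (genN K) t i.opp.deg q (basisN K i.opp) y := by
  rcases i with _ | ⟨x, s⟩
  · exact (congrArg ((lofTree (genN K) t (-1) q).flip y) rep_swap_nY).trans (map_neg _ _)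
  · exact (congrArg ((lofTree (genN K) t 0 q).flip y) (rep_swap_basisN_some x s)).trans
      (map_neg _ _)

theorem lofTree_rep_right_basisM (t : Fin 3) {p : ℤ} (x : (genM K).obj p) (j : Gen) :
    lofTree (genM K) t p (-j.deg) x ((genM K).rep _ (Equiv.swap 0 1) (basisM K j)) =
      lofTree (genM K) t p (-j.opp.deg) x (basisM K j.opp) := by
  rcases j with _ | ⟨y, s⟩
  · exact congrArg (lofTree (genM K) t p 1 x) rep_swap_mY
  · exact congrArg (lofTree (genM K) t p 0 x) (rep_swap_basisM_some y s)

theorem lofTree_rep_left_basisM (t : Fin 3) {q : ℤ} (i : Gen) (y : (genM K).obj q) :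
    lofTree (genM K) t (-i.deg) q ((genM K).rep _ (Equiv.swap 0 1) (basisM K i)) y =
      lofTree (genM K) t (-i.opp.deg) q (basisM K i.opp) y := by
  rcases i with _ | ⟨x, s⟩
  · exact congrArg ((lofTree (genM K) t 1 q).flip y) rep_swap_mY
  · exact congrArg ((lofTree (genM K) t 0 q).flip y) (rep_swap_basisM_some x s)

theorem leftTree_basisN_addRight (i j : Gen) (a : Fin 3) :
    leftTree (genN K) (basisN K i) (basisN K j) (Equiv.addRight a) = treeN K (2 + a) i j :=
  leftTree_addRight _ _ _ _

/-- A reflection is odd, so the upper vertex must be flipped to reach the chosen form; the root leaf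
is the image a - 2 of 2. -/
theorem leftTree_basisN_subLeft (i j : Gen) (a : Fin 3) :
    leftTree (genN K) (basisN K i) (basisN K j) (Equiv.subLeft a) = -treeN K (a - 2) i j.opp :=
  (leftTree_subLeft _ _ _ _).trans (lofTree_rep_right_basisN _ _ _)

theorem rightTree_basisN_addRight (i j : Gen) (a : Fin 3) :
    rightTree (genN K) (basisN K i) (basisN K j) (Equiv.addRight a) = -treeN K a i.opp j := by
  rw [rightTree, addRight_mul_finRotate, leftTree_addRight]
  refine (lofTree_rep_left_basisN _ _ _).trans ?_
  rw [show 2 + (a + 1) = a by revert a; decide]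
  rfl

/-- Both vertices are flipped and the two signs cancel; the root leaf is the image a of 0. -/
theorem rightTree_basisN_subLeft (i j : Gen) (a : Fin 3) :
    rightTree (genN K) (basisN K i) (basisN K j) (Equiv.subLeft a) = treeN K a i.opp j.opp := by
  rw [rightTree, subLeft_mul_finRotate, leftTree_subLeft]
  refine (lofTree_rep_right_basisN _ _ _).trans ?_
  rw [lofTree_rep_left_basisN, neg_neg, show a - 1 - 2 = a by revert a; decide]
  rfl

theorem leftTree_basisM_addRight (i j : Gen) (a : Fin 3) :
    leftTree (genM K) (basisM K i) (basisM K j) (Equiv.addRight a) = treeM K (2 + a) i j :=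
  leftTree_addRight _ _ _ _

theorem leftTree_basisM_subLeft (i j : Gen) (a : Fin 3) :
    leftTree (genM K) (basisM K i) (basisM K j) (Equiv.subLeft a) = treeM K (a - 2) i j.opp :=
  (leftTree_subLeft _ _ _ _).trans (lofTree_rep_right_basisM _ _ _)

theorem rightTree_basisM_addRight (i j : Gen) (a : Fin 3) :
    rightTree (genM K) (basisM K i) (basisM K j) (Equiv.addRight a) = treeM K a i.opp j := by
  rw [rightTree, addRight_mul_finRotate, leftTree_addRight]
  refine (lofTree_rep_left_basisM _ _ _).trans ?_
  rw [show 2 + (a + 1) = a by revert a; decide]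
  rfl

theorem rightTree_basisM_subLeft (i j : Gen) (a : Fin 3) :
    rightTree (genM K) (basisM K i) (basisM K j) (Equiv.subLeft a) = treeM K a i.opp j.opp := by
  rw [rightTree, subLeft_mul_finRotate, leftTree_subLeft]
  refine (lofTree_rep_right_basisM _ _ _).trans ?_
  rw [lofTree_rep_left_basisM, show a - 1 - 2 = a by revert a; decide]
  rfl

end Trees

/-! ### The relations R and S in coordinates -/

section Relations

variable {K : Type u} [Field K]

/-- The relations `S` in terms of the basis of trees. -/
structure DualRel {Q : Type*} [AddCommGroup Q] (q : Fin 3 → Gen → Gen → Q) : Prop where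
  assoc : ∀ x y t, q (2 + t) (some (x, false)) (some (y, false)) =
    -q t (some (x, true)) (some (y, false))
  assoc' : ∀ x y t, q (t - 2) (some (x, false)) (some (y, true)) =
    -q t (some (x, true)) (some (y, true))
  perm : ∀ x y t, q (2 + t) (some (x, false)) (some (y, false)) =
    -q (t - 2) (some (x, false)) (some (y, true))
  comm : ∀ s t, q t (some (true, false)) (some (false, s)) =
    q t (some (false, false)) (some (true, s))
  odd : ∀ t, q (2 + t) none none = q t none none
  bracket : ∀ x t, q (2 + t) none (some (x, false)) = -q (t - 2) (some (x, false)) none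
  bracket' : ∀ x t, q (t - 2) none (some (x, true)) = -q (2 + t) (some (x, false)) none
  leibniz : ∀ x t, q t (some (x, true)) none =
    q (t - 2) (some (x, false)) none + q (2 + t) (some (x, false)) none

/-- The relations `S` for a family of trees `x(y(a, b), c)` and `x(a, y(b, c))`. -/
structure TreeRel {Q : Type*} [AddCommGroup Q] (L R : Gen → Gen → Equiv.Perm (Fin 3) → Q) :
    Prop where
  assoc : ∀ x y σ, L (some (x, false)) (some (y, false)) σ =
    R (some (x, false)) (some (y, false)) σ
  perm : ∀ x y σ, L (some (x, false)) (some (y, false)) σ =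
    L (some (x, false)) (some (y, false)) (σ * Equiv.swap 1 2)
  left : ∀ σ, L (some (true, false)) (some (false, false)) σ =
    L (some (false, false)) (some (true, false)) σ
  right : ∀ σ, R (some (true, false)) (some (false, false)) σ =
    R (some (false, false)) (some (true, false)) σ
  odd : ∀ σ, L none none σ + R none none σ = 0
  bracket : ∀ x σ, L none (some (x, false)) σ =
    L (some (x, false)) none (σ * Equiv.swap 1 2)
  leibniz : ∀ x σ, R (some (x, false)) none σ -
    L (some (x, false)) none (σ * Equiv.swap 1 2) + L (some (x, false)) none σ = 0

/-- The target of ψ is left free because two maps matter: pairing with a relation of R, and the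
projection modulo the span of S. -/
theorem treeRel_iff_dualRel {Q : Type*} [AddCommGroup Q] [Module K Q]
    (ψ : Quad (genN K) →ₗ[K] Q) :
    TreeRel (fun i j σ => ψ (leftTree (genN K) (basisN K i) (basisN K j) σ))
      (fun i j σ => ψ (rightTree (genN K) (basisN K i) (basisN K j) σ)) ↔
      DualRel (fun t i j => ψ (treeN K t i j)) := by
  constructor
  · intro H
    constructor
    · intro x y t
      simpa [leftTree_basisN_addRight, rightTree_basisN_addRight, Gen.opp] using
        H.assoc x y (Equiv.addRight t)
    · intro x y t
      simpa [leftTree_basisN_subLeft, rightTree_basisN_subLeft, Gen.opp, neg_eq_iff_eq_neg] using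
        H.assoc x y (Equiv.subLeft t)
    · intro x y t
      simpa [leftTree_basisN_addRight, leftTree_basisN_subLeft, addRight_mul_swap_one_two,
        Gen.opp] using H.perm x y (Equiv.addRight t)
    · intro s t
      cases s
      · have := H.left (Equiv.addRight (t - 2))
        simpa [leftTree_basisN_addRight] using this
      · have := H.left (Equiv.subLeft (t + 2))
        simpa [leftTree_basisN_subLeft, Gen.opp] using this
    · intro t
      simpa [leftTree_basisN_addRight, rightTree_basisN_addRight, Gen.opp, add_neg_eq_zero] using
        H.odd (Equiv.addRight t)
    · intro x t
      simpa [leftTree_basisN_addRight, leftTree_basisN_subLeft, addRight_mul_swap_one_two,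
        Gen.opp] using H.bracket x (Equiv.addRight t)
    · intro x t
      simpa [leftTree_basisN_addRight, leftTree_basisN_subLeft, subLeft_mul_swap_one_two,
        Gen.opp, neg_eq_iff_eq_neg] using H.bracket x (Equiv.subLeft t)
    · intro x t
      have := H.leibniz x (Equiv.addRight t)
      simp only [leftTree_basisN_addRight, leftTree_basisN_subLeft, rightTree_basisN_addRight,
        addRight_mul_swap_one_two, Gen.opp, map_neg, Bool.not_false] at this
      rw [← sub_eq_zero, ← neg_eq_zero, ← this]
      abel
  · intro H
    constructor
    · intro x y σ
      obtain ⟨a, rfl⟩ | ⟨a, rfl⟩ := perm_three_cases σ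
      · simpa [leftTree_basisN_addRight, rightTree_basisN_addRight, Gen.opp] using H.assoc x y a
      · simpa [leftTree_basisN_subLeft, rightTree_basisN_subLeft, Gen.opp,
          neg_eq_iff_eq_neg] using H.assoc' x y a
    · intro x y σ
      obtain ⟨a, rfl⟩ | ⟨a, rfl⟩ := perm_three_cases σ
      · simpa [leftTree_basisN_addRight, leftTree_basisN_subLeft, addRight_mul_swap_one_two,
          Gen.opp] using H.perm x y a
      · simpa [leftTree_basisN_addRight, leftTree_basisN_subLeft, subLeft_mul_swap_one_two,
          Gen.opp] using (H.perm x y a).symm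
    · intro σ
      obtain ⟨a, rfl⟩ | ⟨a, rfl⟩ := perm_three_cases σ
      · simpa [leftTree_basisN_addRight] using H.comm false (2 + a)
      · simpa [leftTree_basisN_subLeft, Gen.opp] using H.comm true (a - 2)
    · intro σ
      obtain ⟨a, rfl⟩ | ⟨a, rfl⟩ := perm_three_cases σ
      · have := H.comm false (2 + a)
        simpa [rightTree_basisN_addRight, Gen.opp, H.assoc] using this
      · have := H.comm true (a - 2)
        simpa [rightTree_basisN_subLeft, Gen.opp, H.assoc'] using this
    · intro σ
      obtain ⟨a, rfl⟩ | ⟨a, rfl⟩ := perm_three_cases σ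
      · simpa [leftTree_basisN_addRight, rightTree_basisN_addRight, Gen.opp,
          add_neg_eq_zero] using H.odd a
      · have := H.odd (a - 2)
        simp only [add_sub_cancel] at this
        simp [leftTree_basisN_subLeft, rightTree_basisN_subLeft, Gen.opp, this]
    · intro x σ
      obtain ⟨a, rfl⟩ | ⟨a, rfl⟩ := perm_three_cases σ
      · simpa [leftTree_basisN_addRight, leftTree_basisN_subLeft, addRight_mul_swap_one_two,
          Gen.opp] using H.bracket x a
      · simpa [leftTree_basisN_addRight, leftTree_basisN_subLeft, subLeft_mul_swap_one_two,
          Gen.opp, neg_eq_iff_eq_neg] using H.bracket' x a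
    · intro x σ
      obtain ⟨a, rfl⟩ | ⟨a, rfl⟩ := perm_three_cases σ
      · simp only [leftTree_basisN_addRight, leftTree_basisN_subLeft, rightTree_basisN_addRight,
          addRight_mul_swap_one_two, Gen.opp, map_neg, Bool.not_false, H.leibniz]
        abel
      · simp only [leftTree_basisN_addRight, leftTree_basisN_subLeft, rightTree_basisN_subLeft,
          subLeft_mul_swap_one_two, Gen.opp, map_neg, Bool.not_false, H.leibniz]
        abel

theorem vanish_relS_iff_treeRel {Q : Type*} [AddCommGroup Q] [Module K Q]
    (ψ : Quad (genN K) →ₗ[K] Q) :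
    (∀ r ∈ relS K, ψ r = 0) ↔
      TreeRel (fun i j σ => ψ (leftTree (genN K) (basisN K i) (basisN K j) σ))
        (fun i j σ => ψ (rightTree (genN K) (basisN K i) (basisN K j) σ)) := by
  have hsub : ∀ {u v}, ψ (u - v) = 0 ↔ ψ u = ψ v := by
    intro u v
    rw [map_sub, sub_eq_zero]
  have hlbz : ∀ u v w, ψ (u - v + w) = ψ u - ψ v + ψ w := by
    intro u v w
    rw [map_add, map_sub]
  constructor
  · intro H
    constructor
    · rintro (_ | _) (_ | _) σ
      · exact hsub.1 (H _ ⟨σ, .inl rfl⟩)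
      · exact hsub.1 (H _ ⟨σ, .inr (.inr (.inr (.inr (.inr (.inr (.inl rfl))))))⟩)
      · exact hsub.1 (H _ ⟨σ, .inr (.inr (.inr (.inr (.inl rfl))))⟩)
      · exact hsub.1 (H _ ⟨σ, .inr (.inr (.inl rfl))⟩)
    · rintro (_ | _) (_ | _) σ
      · exact hsub.1 (H _ ⟨σ, .inr (.inl rfl)⟩)
      · exact hsub.1 (H _ ⟨σ, .inr (.inr (.inr (.inr (.inr (.inr (.inr (.inl rfl)))))))⟩)
      · exact hsub.1 (H _ ⟨σ, .inr (.inr (.inr (.inr (.inr (.inl rfl)))))⟩)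
      · exact hsub.1 (H _ ⟨σ, .inr (.inr (.inr (.inl rfl)))⟩)
    · intro σ
      exact hsub.1 (H _ ⟨σ, .inr (.inr (.inr (.inr (.inr (.inr (.inr (.inr (.inl rfl))))))))⟩)
    · intro σ
      exact hsub.1 (H _ ⟨σ, .inr (.inr (.inr (.inr (.inr (.inr (.inr (.inr (.inr
        (.inl rfl)))))))))⟩)
    · intro σ
      exact (map_add ψ _ _).symm.trans (H _ ⟨σ, .inr (.inr (.inr (.inr (.inr (.inr (.inr (.inr
        (.inr (.inr (.inl rfl))))))))))⟩)
    · rintro (_ | _) σ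
      · exact hsub.1 (H _ ⟨σ, .inr (.inr (.inr (.inr (.inr (.inr (.inr (.inr (.inr (.inr (.inr
          (.inl rfl)))))))))))⟩)
      · exact hsub.1 (H _ ⟨σ, .inr (.inr (.inr (.inr (.inr (.inr (.inr (.inr (.inr (.inr (.inr
          (.inr (.inr (.inl rfl)))))))))))))⟩)
    · rintro (_ | _) σ
      · exact (hlbz _ _ _).symm.trans (H _ ⟨σ, .inr (.inr (.inr (.inr (.inr (.inr (.inr (.inr
          (.inr (.inr (.inr (.inr (.inl rfl))))))))))))⟩)
      · exact (hlbz _ _ _).symm.trans (H _ ⟨σ, .inr (.inr (.inr (.inr (.inr (.inr (.inr (.inr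
          (.inr (.inr (.inr (.inr (.inr (.inr rfl)))))))))))))⟩)
  · rintro H _ ⟨σ, rfl | rfl | rfl | rfl | rfl | rfl | rfl | rfl | rfl | rfl | rfl | rfl | rfl |
      rfl | rfl⟩
    · exact hsub.2 (H.assoc false false σ)
    · exact hsub.2 (H.perm false false σ)
    · exact hsub.2 (H.assoc true true σ)
    · exact hsub.2 (H.perm true true σ)
    · exact hsub.2 (H.assoc true false σ)
    · exact hsub.2 (H.perm true false σ)
    · exact hsub.2 (H.assoc false true σ)
    · exact hsub.2 (H.perm false true σ)
    · exact hsub.2 (H.left σ)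
    · exact hsub.2 (H.right σ)
    · exact (map_add ψ _ _).trans (H.odd σ)
    · exact hsub.2 (H.bracket false σ)
    · exact (hlbz _ _ _).trans (H.leibniz false σ)
    · exact hsub.2 (H.bracket true σ)
    · exact (hlbz _ _ _).trans (H.leibniz true σ)

/-- The polarised pre-Lie relation in terms of the basis of trees. -/
def preLieComb {Q : Type*} [AddCommGroup Q] (c : Fin 3 → Gen → Gen → Q) (x y : Bool)
    (a : Fin 3) : Q :=
  c (2 + a) (some (x, false)) (some (y, false)) - c a (some (x, true)) (some (y, false))
    - c (a - 2) (some (x, false)) (some (y, true)) + c a (some (x, true)) (some (y, true))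

/-- The Jacobi identity in terms of the basis of trees. -/
def jacobiComb {Q : Type*} [AddCommGroup Q] (c : Fin 3 → Gen → Gen → Q) : Q :=
  c 0 none none + c 1 none none + c 2 none none

/-- The compatibility of the bracket and a product in terms of the basis of trees. -/
def nijComb {Q : Type*} [AddCommGroup Q] (c : Fin 3 → Gen → Gen → Q) (x : Bool)
    (a : Fin 3) : Q :=
  c (2 + a) (some (x, false)) none + c a (some (x, true)) none + c (a + 1) (some (x, true)) none
    - c a none (some (x, false)) - c (a + 1) none (some (x, true))

/-- The relations `R` in terms of the basis of trees. -/
inductive IsRelR {Q : Type*} [AddCommGroup Q] (c : Fin 3 → Gen → Gen → Q) : Q → Prop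
  | preLie (x a) : IsRelR c (preLieComb c x x a)
  | polar (a) : IsRelR c (preLieComb c true false a + preLieComb c false true a)
  | jacobi : IsRelR c (jacobiComb c)
  | nij (x a) : IsRelR c (nijComb c x a)

theorem preLieRel_addRight (x y : Bool) (a : Fin 3) :
    preLieRel (genM K) (basisM K (some (x, false))) (basisM K (some (y, false)))
      (Equiv.addRight a) = preLieComb (treeM K) x y a := by
  simp only [preLieRel, addRight_mul_swap_one_two, leftTree_basisM_addRight,
    leftTree_basisM_subLeft, rightTree_basisM_addRight, rightTree_basisM_subLeft, preLieComb,
    Gen.opp, Bool.not_false]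

/-- The relation is antisymmetric in its last two arguments, so odd permutations give nothing new.
-/
theorem preLieRel_subLeft (x y : Bool) (a : Fin 3) :
    preLieRel (genM K) (basisM K (some (x, false))) (basisM K (some (y, false)))
      (Equiv.subLeft a) = -preLieComb (treeM K) x y a := by
  simp only [preLieRel, subLeft_mul_swap_one_two, leftTree_basisM_addRight,
    leftTree_basisM_subLeft, rightTree_basisM_addRight, rightTree_basisM_subLeft, preLieComb,
    Gen.opp, Bool.not_false]
  abel

theorem nijRel_addRight (x : Bool) (a : Fin 3) :
    nijRel (genM K) (basisM K (some (x, false))) (basisM K none) (Equiv.addRight a) =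
      nijComb (treeM K) x a := by
  simp only [nijRel, addRight_mul_swap_zero_one, leftTree_basisM_addRight,
    rightTree_basisM_addRight, rightTree_basisM_subLeft, nijComb, Gen.opp, Bool.not_false]

/-- The compatibility is symmetric in its first two arguments, so a reflection reproduces the
relation of a translation. -/
theorem nijRel_subLeft (x : Bool) (a : Fin 3) :
    nijRel (genM K) (basisM K (some (x, false))) (basisM K none) (Equiv.subLeft a) =
      nijComb (treeM K) x (a - 1) := by
  simp only [nijRel, subLeft_mul_swap_zero_one, leftTree_basisM_subLeft,
    rightTree_basisM_addRight, rightTree_basisM_subLeft, nijComb, Gen.opp, Bool.not_false,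
    sub_add_cancel, show 2 + (a - 1) = a - 2 by revert a; decide]
  abel

theorem jacobiRel_eq :
    leftTree (genM K) (mY K) (mY K) 1 + leftTree (genM K) (mY K) (mY K) (finRotate 3)
      + leftTree (genM K) (mY K) (mY K) (finRotate 3 * finRotate 3) = jacobiComb (treeM K) := by
  rw [show (1 : Equiv.Perm (Fin 3)) = Equiv.addRight 0 by decide,
    show finRotate 3 = Equiv.addRight 1 by decide,
    show Equiv.addRight 1 * Equiv.addRight 1 = Equiv.addRight (2 : Fin 3) by decide]
  refine (congrArg₂ (· + ·) (congrArg₂ (· + ·) (leftTree_basisM_addRight none none _)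
    (leftTree_basisM_addRight none none _)) (leftTree_basisM_addRight none none _)).trans ?_
  exact (add_assoc _ _ _).trans (add_comm _ _)

theorem vanish_relR_iff {Q : Type*} [AddCommGroup Q] [Module K Q] (ψ : Quad (genM K) →ₗ[K] Q) :
    (∀ r ∈ relR K, ψ r = 0) ↔ ∀ r, IsRelR (treeM K) r → ψ r = 0 := by
  constructor
  · rintro H _ (⟨x, a⟩ | a | _ | ⟨x, a⟩)
    · rw [← preLieRel_addRight]
      cases x
      · exact H _ ⟨_, .inl rfl⟩
      · exact H _ ⟨_, .inr (.inl rfl)⟩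
    · rw [← preLieRel_addRight, ← preLieRel_addRight]
      exact H _ ⟨_, .inr (.inr (.inl rfl))⟩
    · rw [← jacobiRel_eq]
      exact H _ ⟨1, .inr (.inr (.inr (.inl rfl)))⟩
    · rw [← nijRel_addRight]
      cases x
      · exact H _ ⟨_, .inr (.inr (.inr (.inr (.inl rfl))))⟩
      · exact H _ ⟨_, .inr (.inr (.inr (.inr (.inr rfl))))⟩
  · intro H
    have hp : ∀ x σ, ψ (preLieRel (genM K) (basisM K (some (x, false)))
        (basisM K (some (x, false))) σ) = 0 := by
      intro x σ
      obtain ⟨a, rfl⟩ | ⟨a, rfl⟩ := perm_three_cases σ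
      · rw [preLieRel_addRight, H _ (.preLie x a)]
      · rw [preLieRel_subLeft, map_neg, H _ (.preLie x a), neg_zero]
    have hq : ∀ σ, ψ (preLieRel (genM K) (basisM K (some (true, false)))
        (basisM K (some (false, false))) σ + preLieRel (genM K) (basisM K (some (false, false)))
        (basisM K (some (true, false))) σ) = 0 := by
      intro σ
      obtain ⟨a, rfl⟩ | ⟨a, rfl⟩ := perm_three_cases σ
      · rw [preLieRel_addRight, preLieRel_addRight, H _ (.polar a)]
      · rw [preLieRel_subLeft, preLieRel_subLeft, ← neg_add, map_neg, H _ (.polar a), neg_zero]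
    have hn : ∀ x σ, ψ (nijRel (genM K) (basisM K (some (x, false))) (basisM K none) σ) = 0 := by
      intro x σ
      obtain ⟨a, rfl⟩ | ⟨a, rfl⟩ := perm_three_cases σ
      · rw [nijRel_addRight, H _ (.nij x a)]
      · rw [nijRel_subLeft, H _ (.nij x _)]
    rintro _ ⟨σ, rfl | rfl | rfl | rfl | rfl | rfl⟩
    · exact hp false σ
    · exact hp true σ
    · exact hq σ
    · rw [jacobiRel_eq, H _ .jacobi]
    · exact hn false σ
    · exact hn true σ

/-- The relations are fixed integer combinations of the entries of c, hence natural under additive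
maps; this passes between relations among trees and relations among coefficients. -/
theorem IsRelR.exists_of_map {Q Q' : Type*} [AddCommGroup Q] [AddCommGroup Q'] (g : Q →+ Q')
    {c : Fin 3 → Gen → Gen → Q} {r : Q'} (h : IsRelR (fun t i j => g (c t i j)) r) :
    ∃ r', IsRelR c r' ∧ g r' = r := by
  cases h with
  | preLie x a => exact ⟨_, .preLie x a, by simp [preLieComb]⟩
  | polar a => exact ⟨_, .polar a, by simp [preLieComb]⟩
  | jacobi => exact ⟨_, .jacobi, by simp [jacobiComb]⟩
  | nij x a => exact ⟨_, .nij x a, by simp [nijComb]⟩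

theorem DualRel.map {Q Q' : Type*} [AddCommGroup Q] [AddCommGroup Q'] (g : Q →+ Q')
    {q : Fin 3 → Gen → Gen → Q} (h : DualRel q) : DualRel (fun t i j => g (q t i j)) where
  assoc x y t := by rw [← map_neg, h.assoc]
  assoc' x y t := by rw [← map_neg, h.assoc']
  perm x y t := by rw [← map_neg, h.perm]
  comm s t := by rw [h.comm]
  odd t := by rw [h.odd]
  bracket x t := by rw [← map_neg, h.bracket]
  bracket' x t := by rw [← map_neg, h.bracket']
  leibniz x t := by rw [← map_add, h.leibniz]

/-! ### The two inclusions between the span of S and the orthogonal complement -/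

/-- The coefficients of a relation of `R` satisfy the relations `S`. -/
theorem dualRel_coeff (w : Fin 3 → Gen → Gen → ℤ)
    (h : IsRelR (fun t' i' j' t i j => if t = t' ∧ i = i' ∧ j = j' then (1 : ℤ) else 0) w) :
    DualRel w := by
  -- With integer coefficients each clause is an explicit identity over finitely many indices, hence
  -- decidable; the result is cast to K afterwards.
  cases h with
  | preLie x a =>
    constructor <;> (revert x a; decide +kernel)
  | polar a =>
    constructor <;> (revert a; decide +kernel)
  | jacobi => constructor <;> decide +kernel
  | nij x a =>
    constructor <;> (revert x a; decide +kernel)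

/-- This is the inclusion of R^⊥ in the span of S, with q the classes of the trees modulo S and c
the coefficients of an element of R^⊥. -/
theorem sum_eq_zero_of_dualRel {Q : Type*} [AddCommGroup Q] [Module K Q]
    {q : Fin 3 → Gen → Gen → Q} (hq : DualRel q) {c : Fin 3 → Gen → Gen → K}
    (hc : ∀ r, IsRelR c r → r = 0) : ∑ t, ∑ i, ∑ j, c t i j • q t i j = 0 := by
  -- The identities `h1` to `h9` are rewriting rules that express every tree through the 16 normal
  -- forms.
  have h1 : ∀ x y t, q t (some (x, false)) (some (y, true)) =
      -q (t + 1) (some (x, false)) (some (y, false)) := by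
    intro x y t
    have := hq.perm x y (t + 2)
    rw [add_sub_cancel_right, show 2 + (t + 2) = t + 1 by clear this; revert t; decide] at this
    rw [this, neg_neg]
  have h2 : ∀ x y t, q t (some (x, true)) (some (y, false)) =
      -q (t + 2) (some (x, false)) (some (y, false)) := by
    intro x y t
    rw [add_comm t, hq.assoc, neg_neg]
  have h3 : ∀ x y t, q t (some (x, true)) (some (y, true)) =
      q (t + 2) (some (x, false)) (some (y, false)) := by
    intro x y t
    rw [← neg_eq_iff_eq_neg.2 (hq.assoc' x y t), h1, neg_neg,
      show t - 2 + 1 = t + 2 by revert t; decide]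
  have h4 : ∀ t, q t (some (true, false)) (some (false, false)) =
    q t (some (false, false)) (some (true, false)) := hq.comm false
  have h5 : ∀ x t, q t none (some (x, false)) = -q (t + 2) (some (x, false)) none := by
    intro x t
    have := hq.bracket x (t - 2)
    rwa [add_sub_cancel, show t - 2 - 2 = t + 2 by clear this; revert t; decide] at this
  have h6 : ∀ x t, q t none (some (x, true)) = -q (t + 1) (some (x, false)) none := by
    intro x t
    have := hq.bracket' x (t + 2)
    rwa [add_sub_cancel_right, show 2 + (t + 2) = t + 1 by clear this; revert t; decide] at this
  have h7 : ∀ x t, q t (some (x, true)) none =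
      q (t + 1) (some (x, false)) none + q (t + 2) (some (x, false)) none := by
    intro x t
    rw [hq.leibniz, show t - 2 = t + 1 by revert t; decide, add_comm 2 t]
  have h8 : q 1 none none = q 0 none none := by
    rw [← hq.odd 1]; rfl
  have h9 : q 2 none none = q 0 none none := hq.odd 0
  have p := fun x a => hc _ (.preLie x a)
  have m := fun a => hc _ (.polar a)
  have n := fun x a => hc _ (.nij x a)
  have j := hc _ .jacobi
  simp only [preLieComb, jacobiComb, nijComb] at p m n j
  have e0 : ∀ t : Fin 3, t - 2 = t + 1 := by decide
  have e1 : (1 : Fin 3) + 1 = 2 := rfl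
  have e2 : (1 : Fin 3) + 2 = 0 := rfl
  have e3 : (2 : Fin 3) + 1 = 0 := rfl
  have e4 : (2 : Fin 3) + 2 = 1 := rfl
  have p0 := fun x => p x 0
  have p1 := fun x => p x 1
  have p2 := fun x => p x 2
  have m0 := m 0
  have m1 := m 1
  have m2 := m 2
  have n0 := fun x => n x 0
  have n1 := fun x => n x 1
  have n2 := fun x => n x 2
  simp only [e0, e1, e3, e4, zero_add, add_zero] at p0 p1 p2 m0 m1 m2 n0 n1 n2
  simp only [Fin.sum_univ_three, Fintype.sum_option, Fintype.sum_prod_type, Fintype.sum_bool,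
    h1, h2, h3, h4, h5, h6, h7, h8, h9, e1, e2, e3, e4, zero_add]
  -- Each normal form is multiplied by the relation of R that is its coefficient: `p` for two
  -- products of one colour, `m` for mixed colours, `j` for two brackets, `n` for a product over
  -- which a bracket is grafted.
  linear_combination (norm := module) p0 false • q 2 (some (false, false)) (some (false, false)) +
    p1 false • q 0 (some (false, false)) (some (false, false)) +
    p2 false • q 1 (some (false, false)) (some (false, false)) +
    p0 true • q 2 (some (true, false)) (some (true, false)) +
    p1 true • q 0 (some (true, false)) (some (true, false)) +
    p2 true • q 1 (some (true, false)) (some (true, false)) +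
    m0 • q 2 (some (false, false)) (some (true, false)) +
    m1 • q 0 (some (false, false)) (some (true, false)) +
    m2 • q 1 (some (false, false)) (some (true, false)) +
    j • q 0 none none +
    n0 false • q 2 (some (false, false)) none + n1 false • q 0 (some (false, false)) none +
    n2 false • q 1 (some (false, false)) none +
    n0 true • q 2 (some (true, false)) none + n1 true • q 0 (some (true, false)) none +
    n2 true • q 1 (some (true, false)) none

theorem quadMap_surjective {E F : BinModule K} (φ : E.Iso F) :
    Function.Surjective (quadMap φ) :=
  (DirectSum.lmap_surjective _).2 fun s =>
    TensorProduct.map_surjective (φ.toEquiv s.2.1).surjective (φ.toEquiv s.2.2).surjective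

theorem quadPairing_relS_relR {s : Quad (genN K)} (hs : s ∈ relS K) {r : Quad (genM K)}
    (hr : r ∈ relR K) : quadPairing (genM K) (quadMap (dualIso K) s) r = 0 := by
  refine (vanish_relR_iff (quadPairing (genM K) (quadMap (dualIso K) s))).2 (fun r hr => ?_) r hr
  let ψ : Quad (genN K) →ₗ[K] K := ((quadPairing (genM K)).comp (quadMap (dualIso K))).flip r
  refine (vanish_relS_iff_treeRel ψ).2 ((treeRel_iff_dualRel ψ).2 ?_) s hs
  -- Pairing with r has on basis trees the integer coefficients of r, obtained by writing the same
  -- relation in Kronecker deltas.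
  obtain ⟨w, hw, hψ⟩ : ∃ w : Fin 3 → Gen → Gen → ℤ, IsRelR (fun t' i' j' t i j =>
      if t = t' ∧ i = i' ∧ j = j' then (1 : ℤ) else 0) w ∧
      ∀ t i j, ψ (treeN K t i j) = w t i j := by
    have hδ : ∀ t i j t' i' j', quadPairing (genM K) (quadMap (dualIso K) (treeN K t i j))
        (treeM K t' i' j') = ((if t = t' ∧ i = i' ∧ j = j' then (1 : ℤ) else 0 : ℤ) : K) := by
      intro t i j t' i' j'
      rw [quadPairing_treeN_treeM]
      split_ifs <;> simp
    cases hr with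
    | preLie x a => exact ⟨_, .preLie x a, by simp [ψ, preLieComb, hδ]⟩
    | polar a => exact ⟨_, .polar a, by simp [ψ, preLieComb, hδ]⟩
    | jacobi => exact ⟨_, .jacobi, by simp [ψ, jacobiComb, hδ]⟩
    | nij x a => exact ⟨_, .nij x a, by simp [ψ, nijComb, hδ]⟩
  simpa only [hψ, Int.coe_castAddHom] using (dualRel_coeff w hw).map (Int.castAddHom K)

/-- The relations `S` span the orthogonal complement of the relations `R`. -/
theorem map_span_relS :
    (Submodule.span K (relS K)).map (quadMap (dualIso K)) = (biNij K).orth := by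
  apply le_antisymm
  · rw [Submodule.map_span]
    refine Submodule.span_le.2 ?_
    rintro _ ⟨s, hs, rfl⟩ r hr
    have h : Submodule.span K (relR K) ≤
        LinearMap.ker (quadPairing (genM K) (quadMap (dualIso K) s)) :=
      Submodule.span_le.2 fun r hr => quadPairing_relS_relR hs hr
    exact h hr
  · intro f (hf : ∀ r ∈ Submodule.span K (relR K), quadPairing (genM K) f r = 0)
    obtain ⟨f, rfl⟩ : ∃ g, quadMap (dualIso K) g = f := quadMap_surjective (dualIso K) f
    refine Submodule.mem_map_of_mem ?_
    -- Membership in the span of S is vanishing in the quotient, where the expansion of f in basis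
    -- trees becomes the sum treated above.
    rw [← Submodule.Quotient.mk_eq_zero, ← Submodule.mkQ_apply, ← sum_treeN f]
    simp only [map_sum, map_smul]
    refine sum_eq_zero_of_dualRel ((treeRel_iff_dualRel _).1 ((vanish_relS_iff_treeRel _).1
      fun r hr => ?_)) fun c hc => ?_
    · exact (Submodule.Quotient.mk_eq_zero _).2 (Submodule.subset_span hr)
    · obtain ⟨r, hr, rfl⟩ := IsRelR.exists_of_map
        (quadPairing (genM K) (quadMap (dualIso K) f)).toAddMonoidHom hc
      exact (vanish_relR_iff _).1 (fun r hr => hf r (Submodule.subset_span hr)) r hr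

end Relations

end BiNijenhuis

theorem mainTheorem9 (K : Type u) [Field K] [CharZero K] :
    ∃ φ : (genN K).Iso (genM K).czechDual,
      φ.toEquiv (-1) (nY K) = dualY K ∧
      φ.toEquiv 0 (nW K) = dualW K ∧
      φ.toEquiv 0 (nB K) = dualB K ∧
      (Submodule.span K (relS K)).map (quadMap φ) = (biNij K).orth ∧
      ∃ Φ : (biNijDual K).operad.Iso (biNij K).koszulDual.operad,
        ∀ (d : ℤ) (x : (genN K).obj d),
          Φ.toEquiv 2 d ((biNijDual K).gen x) =
            (biNij K).koszulDual.gen (φ.toEquiv d x) := by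
  exact ⟨dualIso K, dualIso_nY, dualIso_nW, dualIso_nB, map_span_relS,
    (biNijDual K).operadIso (biNij K).koszulDual (dualIso K) map_span_relS,
    QuadraticData.operadIso_gen (biNijDual K) (biNij K).koszulDual (dualIso K) map_span_relS⟩
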